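/- **Setting.** Fix sets $\mathsf{Tid}$ (thread identifiers) and $\mathsf{Id}$ (action identifiers). The register object has methods $\mathtt{read},\mathtt{write}$ and values $\mathbb N$; its actions are invocations $\mathtt{inv}\langle m,v,p,k\rangle$ and responses $\mathtt{res}\langle m,v,p,k\rangle$ with $v\in\mathbb N\cup\{\bot\}$, $p\in\mathsf{Tid}$, $k\in\mathsf{Id}$. A history is a finite sequence of actions. It is *sequential* if it alternates between invocations and responses, starting with an invocation (the last one may be unanswered), each response has the same method, thread and action identifier as the invocation just before it, and no two invocations carry the same pair $(p,k)$. It is *well-formed* if its restriction $h|_p$ to each thread $p$ is sequential; operations of a history are identified by their pair $(p,k)$, and $o_1<_h o_2$ means that the response of $o_1$ occurs in $h$ before the invocation of $o_2$. $\mathsf{Spec}_{\mathsf{Reg}}$ is the set of sequential histories in which, starting from register value $0$, every read takes argument $\bot$ and returns the current value, and every write takes some $n\in\mathbb N$, sets the register to $n$ and returns $\bot$. A sequential history $s$ is a *linearization* of $h$ ($h\sqsubseteq s$) if for some sequence $r$ of responses $h\cdot r$ is well-formed and, with $h'$ the subsequence of $h\cdot r$ of the actions of completed operations, $s|_p=h'|_p$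 for all $p$ and ${<_{h'}}\subseteq{<_s}$. A *register implementation* is a labeled transition system (LTS) whose labels are the register actions and a set of internal labels, such that for every (finite) execution $e$ the induced history $\mathsf{h}(e)$ is well-formed and its invocations have arguments of the right kind ($\bot$ for reads, a natural number for writes). It is *write strongly-linearizable* if there is a map $L$ from its executions to $\mathsf{Spec}_{\mathsf{Reg}}$ with $\mathsf{h}(e)\sqsubseteq L(e)$ for all $e$, and such that $L(e_1)|_{\mathtt{write}}$ is a prefix of $L(e_2)|_{\mathtt{write}}$ whenever $e_1$ is a prefix of $e_2$. An LTS $I$ is *forward-simulated* by $J$ if there is a relation $R$ between their states that relates the initial states and such that whenever $(q,q')\in R$ and $q\xrightarrow{\sigma}q_1$ in $I$, there are a state $q_1'$ and a finite (possibly empty) sequence of transitions of $J$ from $q'$ to $q_1'$ whose labels, restricted to invocations and responses, equal $\sigma$ so restricted, and $(q_1,q_1')\in R$. A *client program* $P$ is an LTS whose labels are the register actions and a set of program-internal labels; $P[I]$ is the parallel composition of $P$ and $I$ synchronizing on the register actions. A *scheduler* $S$ of an LTS maps each execution to a set of transitions; an execution is consistent with $S$ if each of its transitions belongs to the set that $S$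 assigns to the prefix preceding it. A scheduler of $P[I]$ is *deterministic* if each of its sets has at most one element or contains only program-internal transitions. $I$ *strongly observationally refines* $J$ if for every client program $P$ and every deterministic scheduler $S$ of $P[I]$ there is a deterministic scheduler $S'$ of $P[J]$ such that the traces of the executions of $P[I]$ consistent with $S$ and those of $P[J]$ consistent with $S'$ have the same set of restrictions to the labels of $P$. **The register $\mathtt{WSR}$.** Its state consists of the register value $x\in\mathbb N$ and, for each thread $p$, the sequence $ID(p)$ of used action identifiers, a location $PC(p)\in\{\mathtt{main},\mathtt{w_b},\mathtt{w_e},\mathtt{r_b},\mathtt{r_l},\mathtt{r_e}\}$, a set $VS(p)\subseteq\mathbb N$ of loaded values and a value $A(p)\in\mathbb N$; initially $x=0$, $ID(p)=\varepsilon$, $PC(p)=\mathtt{main}$, $VS(p)=\emptyset$, $A(p)=0$. Its internal labels are the thread identifiers. The transitions of thread $p$ are: - label $\mathtt{inv}\langle\mathtt{read},\bot,p,k\rangle$: if $PC(p)=\mathtt{main}$ and $k\notin ID(p)$, append $k$ to $ID(p)$ and set $PC(p):=\mathtt{r_b}$; - internal: if $PC(p)=\mathtt{r_b}$, set $PC(p):=\mathtt{r_l}$,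 $VS(p):=\{x\}$; - internal: if $PC(p)=\mathtt{r_l}$ and $x\notin VS(p)$, add $x$ to $VS(p)$; - internal: if $PC(p)=\mathtt{r_l}$ and $n\in VS(p)$, set $PC(p):=\mathtt{r_e}$, $A(p):=n$; - label $\mathtt{res}\langle\mathtt{read},A(p),p,k\rangle$: if $PC(p)=\mathtt{r_e}$ and $k$ is last in $ID(p)$, set $PC(p):=\mathtt{main}$, $VS(p):=\emptyset$, $A(p):=0$; - label $\mathtt{inv}\langle\mathtt{write},n,p,k\rangle$: if $PC(p)=\mathtt{main}$ and $k\notin ID(p)$, append $k$ to $ID(p)$ and set $PC(p):=\mathtt{w_b}$, $A(p):=n$; - internal: if $PC(p)=\mathtt{w_b}$, set $x:=A(p)$, $PC(p):=\mathtt{w_e}$; - label $\mathtt{res}\langle\mathtt{write},\bot,p,k\rangle$: if $PC(p)=\mathtt{w_e}$ and $k$ is last in $ID(p)$, set $PC(p):=\mathtt{main}$, $VS(p):=\emptyset$, $A(p):=0$. **Theorem.** $\mathtt{WSR}$ is complete for the class of write strongly-linearizable register implementations: $\mathtt{WSR}$ is a write strongly-linearizable register implementation, and every write strongly-linearizable register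 implementation $I$ is forward-simulated by $\mathtt{WSR}$. Moreover, every such $I$ strongly observationally refines $\mathtt{WSR}$. -/

import Mathlib

namespace HyperReg

universe u v w u' v' x y

/-! # Labeled transition systems -/

/-- A labeled transition system with states `Q` and alphabet `Λ`. -/
structure LTS (Q : Type u) (Λ : Type v) where
  init : Q
  tr : Q → Λ → Q → Prop

namespace LTS

variable {Q : Type u} {Λ : Type v}

/-- The transitions of `A`: triples `(pre, label, post)` in its transition relation. -/
@[ext]
structure Transition (A : LTS Q Λ) where
  pre : Q
  label : Λ
  post : Q
  valid : A.tr pre label post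

/-- A sequence of transitions of `A` that starts in state `q` and in which every further
transition continues from the target of the previous one. -/
def IsPath (A : LTS Q Λ) : Q → List A.Transition → Prop
  | _, [] => True
  | q, t :: ts => t.pre = q ∧ A.IsPath t.post ts

/-- The (finite, possibly empty) executions of `A`. -/
def Exec (A : LTS Q Λ) : Type (max u v) :=
  {e : List A.Transition // A.IsPath A.init e}

/-- The trace induced by an execution. -/
def Exec.trace {A : LTS Q Λ} (e : A.Exec) : List Λ := e.1.map Transition.label

/-- `e₁` is a prefix of `e₂`. -/
def Exec.IsPrefix {A : LTS Q Λ} (e₁ e₂ : A.Exec) : Prop := e₁.1 <+: e₂.1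

/-- `A.Steps q ρ q'`: `A` can move from `q` to `q'` by transitions labeled `ρ[1], …, ρ[|ρ|]`. -/
inductive Steps (A : LTS Q Λ) : Q → List Λ → Q → Prop
  | nil (q : Q) : Steps A q [] q
  | cons {q q' q'' : Q} {l : Λ} {ρ : List Λ} :
      A.tr q l q' → Steps A q' ρ q'' → Steps A q (l :: ρ) q''

end LTS

/-! # Actions and histories of an object with method names `M` and values `V` -/

/-- Invocations `inv⟨m, v, p, k⟩` and responses `res⟨m, v, p, k⟩`, where `v` is a value or `⊥`
(written `none`), `p` is a thread identifier and `k` is an action identifier. -/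
inductive Action (M : Type*) (V : Type*) (Tid : Type*) (Id : Type*)
  | inv (m : M) (v : Option V) (p : Tid) (k : Id)
  | res (m : M) (v : Option V) (p : Tid) (k : Id)

namespace Action

variable {M : Type*} {V : Type*} {Tid : Type*} {Id : Type*}

def method : Action M V Tid Id → M
  | inv m _ _ _ => m
  | res m _ _ _ => m

def tid : Action M V Tid Id → Tid
  | inv _ _ p _ => p
  | res _ _ p _ => p

def id : Action M V Tid Id → Id
  | inv _ _ _ k => k
  | res _ _ _ k => k

/-- The pair of thread and action identifiers; it identifies an operation in a history. -/
def key (a : Action M V Tid Id) : Tid × Id := (a.tid, a.id)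

/-- The identifiers of the operation that an invocation starts. -/
def invKey? : Action M V Tid Id → Option (Tid × Id)
  | inv _ _ p k => some (p, k)
  | res _ _ _ _ => none

def IsInv : Action M V Tid Id → Prop
  | inv _ _ _ _ => True
  | res _ _ _ _ => False

def IsRes : Action M V Tid Id → Prop
  | inv _ _ _ _ => False
  | res _ _ _ _ => True

end Action

/-- Histories: finite sequences of invocations and responses. -/
abbrev History (M : Type*) (V : Type*) (Tid : Type*) (Id : Type*) := List (Action M V Tid Id)

namespace History

variable {M : Type*} {V : Type*} {Tid : Type*} {Id : Type*}

/-- The history starts with an invocation and alternates between invocations and responses, and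
every response has the same method, thread and action identifiers as the invocation right
before it. The last invocation may be unanswered. -/
def Alternating : History M V Tid Id → Prop
  | [] => True
  | [a] => a.IsInv
  | a :: b :: h =>
      a.IsInv ∧ b.IsRes ∧ a.method = b.method ∧ a.tid = b.tid ∧ a.id = b.id ∧ Alternating h

/-- Sequential histories: alternating ones in which no two invocations carry the same
(thread and action) identifiers. -/
def Sequential (h : History M V Tid Id) : Prop :=
  Alternating h ∧ (h.filterMap Action.invKey?).Nodup

open Classical in
/-- The restriction `h|p` to the actions of the thread `p`. -/
noncomputable def restrictTid (h : History M V Tid Id) (p : Tid) : History M V Tid Id :=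
  h.filter fun a => a.tid = p

open Classical in
/-- The restriction `h|m` to the actions of the method `m`. -/
noncomputable def restrictMethod (h : History M V Tid Id) (m : M) : History M V Tid Id :=
  h.filter fun a => a.method = m

/-- A history is well-formed if its restriction to each thread is sequential. -/
def WellFormed (h : History M V Tid Id) : Prop :=
  ∀ p : Tid, Sequential (restrictTid h p)

/-- The operation with identifiers `o` is completed in `h`. -/
def CompletedOp (h : History M V Tid Id) (o : Tid × Id) : Prop :=
  (∃ i ∈ h, i.IsInv ∧ i.key = o) ∧ (∃ r ∈ h, r.IsRes ∧ r.key = o)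

open Classical in
/-- The subsequence of the actions that belong to completed operations. -/
noncomputable def completed (h : History M V Tid Id) : History M V Tid Id :=
  h.filter fun a => CompletedOp h a.key

/-- The real-time order: the response of `o₁` appears in `h` before the invocation of `o₂`. -/
def RealTime (h : History M V Tid Id) (o₁ o₂ : Tid × Id) : Prop :=
  ∃ r i : Action M V Tid Id,
    r.IsRes ∧ r.key = o₁ ∧ i.IsInv ∧ i.key = o₂ ∧ List.Sublist [r, i] h

/-- `IsLinearization h s`: the sequential history `s` is a linearization of `h`. That is, one can
append to `h` responses `rs` of some of its pending invocations such that `s` has the same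
per-thread restrictions as `completed (h ++ rs)` and preserves its real-time order. -/
def IsLinearization (h s : History M V Tid Id) : Prop :=
  Sequential s ∧
  ∃ rs : History M V Tid Id,
    (∀ a ∈ rs, a.IsRes) ∧ WellFormed (h ++ rs) ∧
    (∀ p : Tid, restrictTid s p = restrictTid (completed (h ++ rs)) p) ∧
    ∀ o₁ o₂ : Tid × Id, RealTime (completed (h ++ rs)) o₁ o₂ → RealTime s o₁ o₂

end History

/-! # Implementations, client programs and their comparison

`Act` is the set of invocations and responses of the object. An implementation is an LTS over
`Act ⊕ ι`, where `ι` is its set of internal labels; a client program is an LTS over `Act ⊕ π`,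
where `π` is its set of internal labels. -/

section Implementations

variable {Act : Type w}

/-- The restriction of a sequence of labels to the invocations and responses. -/
def external {ι : Type*} (ρ : List (Act ⊕ ι)) : List Act := ρ.filterMap Sum.getLeft?

/-- The history induced by an execution. -/
def LTS.Exec.hist {Q : Type u} {ι : Type v} {I : LTS Q (Act ⊕ ι)} (e : I.Exec) : List Act :=
  external e.trace

/-- Forward simulation (with respect to invocations and responses) from `I` to `J`. -/
def ForwardSimulated {Q : Type u} {ι : Type v} {Q' : Type u'} {ι' : Type v'}
    (I : LTS Q (Act ⊕ ι)) (J : LTS Q' (Act ⊕ ι')) : Prop :=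
  ∃ R : Q → Q' → Prop,
    R I.init J.init ∧
    ∀ (q q₁ : Q) (l : Act ⊕ ι) (q' : Q'), I.tr q l q₁ → R q q' →
      ∃ (q₁' : Q') (ρ : List (Act ⊕ ι')),
        J.Steps q' ρ q₁' ∧ external ρ = external [l] ∧ R q₁ q₁'

/-- Labels of a program linked with an implementation. -/
inductive LinkLabel (Act : Type*) (ι : Type*) (π : Type*)
  | ext (a : Act)
  | impl (i : ι)
  | prog (j : π)

namespace LinkLabel

variable {ι : Type*} {π : Type*}

/-- The label as a label of the program, if it is one. -/
def toProg? : LinkLabel Act ι π → Option (Act ⊕ π)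
  | ext a => some (Sum.inl a)
  | impl _ => none
  | prog j => some (Sum.inr j)

/-- The label is an internal label of the program. -/
def IsProgInternal : LinkLabel Act ι π → Prop
  | ext _ => False
  | impl _ => False
  | prog _ => True

end LinkLabel

/-- The linked system `P[I]`: it interleaves the steps of `P` and `I`, which synchronize on the
invocations and responses. -/
def link {QP : Type*} {π : Type*} {Q : Type*} {ι : Type*}
    (P : LTS QP (Act ⊕ π)) (I : LTS Q (Act ⊕ ι)) : LTS (QP × Q) (LinkLabel Act ι π) where
  init := (P.init, I.init)
  tr s l s' :=
    match l with
    | .ext a => P.tr s.1 (Sum.inl a) s'.1 ∧ I.tr s.2 (Sum.inl a) s'.2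
    | .impl i => s'.1 = s.1 ∧ I.tr s.2 (Sum.inr i) s'.2
    | .prog j => P.tr s.1 (Sum.inr j) s'.1 ∧ s'.2 = s.2

/-- A scheduler assigns to every execution a set of transitions that may be taken next. -/
def Scheduler {Q : Type*} {Λ : Type*} (A : LTS Q Λ) := A.Exec → Set A.Transition

/-- The execution `e` is consistent with the scheduler `S`: each of its transitions is allowed by
`S` after the prefix of `e` that precedes it. -/
def Scheduler.Consistent {Q : Type*} {Λ : Type*} {A : LTS Q Λ} (S : Scheduler A)
    (e : A.Exec) : Prop :=
  ∀ (e₁ : A.Exec) (t : A.Transition), e₁.1 ++ [t] <+: e.1 → t ∈ S e₁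

/-- A scheduler of a linked system is deterministic if after each execution it allows at most one
transition, or only internal transitions of the program. -/
def Scheduler.Deterministic {Q : Type*} {ι : Type*} {π : Type*}
    {A : LTS Q (LinkLabel Act ι π)} (S : Scheduler A) : Prop :=
  ∀ e : A.Exec, (S e).Subsingleton ∨ ∀ t ∈ S e, t.label.IsProgInternal

/-- The traces of the program that occur in executions of the linked system under `S`. -/
def Scheduler.progTraces {Q : Type*} {ι : Type*} {π : Type*}
    {A : LTS Q (LinkLabel Act ι π)} (S : Scheduler A) : Set (List (Act ⊕ π)) :=
  {ρ | ∃ e : A.Exec, S.Consistent e ∧ ρ = e.trace.filterMap LinkLabel.toProg?}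

/-- Strong observational refinement: for every client program `P` and every deterministic
scheduler of `P[I]` there is a deterministic scheduler of `P[J]` that generates exactly the same
set of program traces. -/
def StronglyRefines {Q : Type u} {ι : Type v} {Q' : Type u'} {ι' : Type v'}
    (I : LTS Q (Act ⊕ ι)) (J : LTS Q' (Act ⊕ ι')) : Prop :=
  ∀ (QP : Type x) (π : Type y) (P : LTS QP (Act ⊕ π)) (S : Scheduler (link P I)),
    S.Deterministic →
      ∃ S' : Scheduler (link P J), S'.Deterministic ∧ S.progTraces = S'.progTraces

end Implementations

/-! # Registers -/

inductive RegMethod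
  | read
  | write

/-- The invocations and responses of the register object, whose values are the naturals. -/
abbrev RegAction (Tid : Type*) (Id : Type*) := Action RegMethod ℕ Tid Id

abbrev RegHistory (Tid : Type*) (Id : Type*) := History RegMethod ℕ Tid Id

section Registers

variable {Tid : Type*} {Id : Type*}

/-- A read takes no argument, a write takes a natural number. -/
def ValidArgument : RegAction Tid Id → Prop
  | .inv .read v _ _ => v = none
  | .inv .write v _ _ => ∃ n, v = some n
  | .res _ _ _ _ => True

/-- `RegLegal x s`: running the operations of `s` one after the other on a register that holds `x`,
every read returns the current value and every write installs its argument (and returns `⊥`). -/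
def RegLegal : ℕ → RegHistory Tid Id → Prop
  | _, [] => True
  | _, [.inv .read none _ _] => True
  | _, [.inv .write (some _) _ _] => True
  | x, .inv .read none _ _ :: .res .read v _ _ :: s => v = some x ∧ RegLegal x s
  | _, .inv .write (some n) _ _ :: .res .write v _ _ :: s => v = none ∧ RegLegal n s
  | _, _ => False

/-- The sequential specification of the register with initial value `0`. -/
def regSpec (Tid : Type*) (Id : Type*) : Set (RegHistory Tid Id) :=
  {s | History.Sequential s ∧ RegLegal 0 s}

/-- Register implementations: every execution induces a well-formed history, whose invocations
carry arguments as the methods of the register take them. -/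
def IsRegisterImplementation {Q : Type u} {ι : Type v} (I : LTS Q (RegAction Tid Id ⊕ ι)) : Prop :=
  ∀ e : I.Exec, History.WellFormed e.hist ∧ ∀ a ∈ e.hist, ValidArgument a

/-- Linearization mappings of `I` into the register specification. -/
def IsLinearizationMapping {Q : Type u} {ι : Type v} (I : LTS Q (RegAction Tid Id ⊕ ι))
    (L : I.Exec → RegHistory Tid Id) : Prop :=
  ∀ e : I.Exec, L e ∈ regSpec Tid Id ∧ History.IsLinearization e.hist (L e)

/-- A linearization mapping is write strong if the writes of `L e₁` form a prefix of the writes of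
`L e₂` whenever `e₁` is a prefix of `e₂`. -/
def IsWriteStrong {Q : Type u} {ι : Type v} (I : LTS Q (RegAction Tid Id ⊕ ι))
    (L : I.Exec → RegHistory Tid Id) : Prop :=
  ∀ e₁ e₂ : I.Exec, e₁.IsPrefix e₂ →
    History.restrictMethod (L e₁) .write <+: History.restrictMethod (L e₂) .write

/-- The class of write strongly-linearizable register implementations. -/
def WriteStronglyLinearizable {Q : Type u} {ι : Type v}
    (I : LTS Q (RegAction Tid Id ⊕ ι)) : Prop :=
  IsRegisterImplementation I ∧
    ∃ L : I.Exec → RegHistory Tid Id, IsLinearizationMapping I L ∧ IsWriteStrong I L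

end Registers

/-! # The write strong register -/

namespace WSR

/-- Program locations. -/
inductive PC
  | main
  | wBegin
  | wEnd
  | rBegin
  | rLoop
  | rEnd

/-- Register value, used action identifiers, program counters, sets of values collected by the
reads, and input/output arguments of the methods. -/
structure State (Tid : Type*) (Id : Type*) where
  val : ℕ
  ids : Tid → List Id
  pc : Tid → PC
  vs : Tid → Set ℕ
  arg : Tid → ℕ

open Classical in
/-- The transitions; the internal label `Sum.inr p` stands for an internal step of thread `p`. -/
inductive Step {Tid : Type*} {Id : Type*} :
    State Tid Id → RegAction Tid Id ⊕ Tid → State Tid Id → Prop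
  | readInv (s : State Tid Id) (p : Tid) (k : Id) :
      s.pc p = .main → k ∉ s.ids p →
      Step s (Sum.inl (.inv .read none p k))
        { s with
          ids := Function.update s.ids p (s.ids p ++ [k])
          pc := Function.update s.pc p .rBegin }
  | readInit (s : State Tid Id) (p : Tid) :
      s.pc p = .rBegin →
      Step s (Sum.inr p)
        { s with
          pc := Function.update s.pc p .rLoop
          vs := Function.update s.vs p {s.val} }
  | readLoop (s : State Tid Id) (p : Tid) :
      s.pc p = .rLoop → s.val ∉ s.vs p →
      Step s (Sum.inr p)
        { s with vs := Function.update s.vs p (s.vs p ∪ {s.val}) }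
  | readPick (s : State Tid Id) (p : Tid) (out : ℕ) :
      s.pc p = .rLoop → out ∈ s.vs p →
      Step s (Sum.inr p)
        { s with
          pc := Function.update s.pc p .rEnd
          arg := Function.update s.arg p out }
  | readRes (s : State Tid Id) (p : Tid) (k : Id) :
      s.pc p = .rEnd → (s.ids p).getLast? = some k →
      Step s (Sum.inl (.res .read (some (s.arg p)) p k))
        { s with
          pc := Function.update s.pc p .main
          vs := Function.update s.vs p ∅
          arg := Function.update s.arg p 0 }
  | writeInv (s : State Tid Id) (p : Tid) (k : Id) (n : ℕ) :
      s.pc p = .main → k ∉ s.ids p →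
      Step s (Sum.inl (.inv .write (some n) p k))
        { s with
          ids := Function.update s.ids p (s.ids p ++ [k])
          pc := Function.update s.pc p .wBegin
          arg := Function.update s.arg p n }
  | writeInt (s : State Tid Id) (p : Tid) :
      s.pc p = .wBegin →
      Step s (Sum.inr p)
        { s with
          val := s.arg p
          pc := Function.update s.pc p .wEnd }
  | writeRes (s : State Tid Id) (p : Tid) (k : Id) :
      s.pc p = .wEnd → (s.ids p).getLast? = some k →
      Step s (Sum.inl (.res .write none p k))
        { s with
          pc := Function.update s.pc p .main
          vs := Function.update s.vs p ∅
          arg := Function.update s.arg p 0 }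

end WSR

/-- The write strong register `WSR`. -/
def WSR (Tid : Type*) (Id : Type*) : LTS (WSR.State Tid Id) (RegAction Tid Id ⊕ Tid) where
  init :=
    { val := 0
      ids := fun _ => []
      pc := fun _ => .main
      vs := fun _ => ∅
      arg := fun _ => 0 }
  tr := WSR.Step

end HyperReg

universe t k u v x y

/-! Three arguments are combined.

(1) `WSR` is write strongly-linearizable. A write is linearized at its internal step, once and for
all. A read that is going to pick `n` is linearized at the moment it first loads `n`, when `n` is
the current register value. Which value that is depends on the future, so the linearization of an
execution is built with a look-ahead (`WSR.pick`). The look-ahead affects only the reads: the writes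
are the concatenation of the effects of the single transitions, hence monotone in the execution.
`Linearizing` is the invariant of the construction, `inv`, `lin` and `res` are its moves, and
`Linearizing.isLinearization` turns it into a linearization.

(2) Let `L` be a write strong linearization mapping of `I`. `WSR` simulates `I` by executing the
writes of `L e` in their order, as late as possible, while every pending read collects every value
that appears. Only responses force progress. If `m` writes are executed, the invariant `Safe` says
that in the linearizations of all extensions of `e` an operation not yet invoked has at least `m`
writes before it; a read invoked now therefore has at least `m` writes before it forever (`Bound`),
and starting to load at this point misses no value it might return. When a write responds, `WSR`
catches up to that write; its index is permanent, because the writes only grow at the end. When a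
read responds with `n`, its place among the writes is not permanent, as extensions may linearize it
elsewhere. `WSR` therefore advances only to the least `j`, not below the bound of the read, such
that the value after `j` writes is `n`. The read has then loaded `n`, and by minimality every
admissible place of the read has at least `j` writes before it, which restores `Safe`
(`safe_of_read_completed`).

(3) Forward simulation gives strong observational refinement. Fixing one matching run for each
transition maps executions of `P[I]` to executions of `P[J]`, monotonically for prefixes; the new
scheduler follows the images of the executions consistent with the old one. Two images can part only
where the originals part, that is, at program-internal transitions, and each of these is matched by
a single program-internal transition. -/

namespace HyperReg

/-! ### Alternating, sequential and well-formed histories -/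

namespace History

variable {M : Type*} {V : Type*} {Tid : Type*} {Id : Type*}

/-- The action `b` may follow the last action `a?` of an alternating history. -/
def CanFollow : Option (Action M V Tid Id) → Action M V Tid Id → Prop
  | none, b => b.IsInv
  | some a, b =>
      (a.IsRes ∧ b.IsInv) ∨
      (a.IsInv ∧ b.IsRes ∧ a.method = b.method ∧ a.tid = b.tid ∧ a.id = b.id)

theorem not_isRes_of_isInv {a : Action M V Tid Id} (h : a.IsInv) : ¬ a.IsRes := by
  cases a <;> simp_all [Action.IsInv, Action.IsRes]

theorem isInv_or_isRes (a : Action M V Tid Id) : a.IsInv ∨ a.IsRes := by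
  cases a <;> simp [Action.IsInv, Action.IsRes]

/-- Executions grow at the end, while `Alternating` recurses from the front; this converts one into
the other. -/
theorem alternating_concat : ∀ (l : History M V Tid Id) (b : Action M V Tid Id),
    Alternating (l ++ [b]) ↔ Alternating l ∧ CanFollow l.getLast? b
  | [], b => by simp [Alternating, CanFollow]
  | [a], b => by
      have := @not_isRes_of_isInv M V Tid Id a
      simp only [List.cons_append, List.nil_append, Alternating, List.getLast?_singleton, CanFollow]
      tauto
  | a :: c :: l, b => by
      have ih := alternating_concat l b
      have hc := @not_isRes_of_isInv M V Tid Id c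
      simp only [List.cons_append, Alternating, ih]
      cases l with
      | nil => simp only [List.getLast?_nil, CanFollow, List.getLast?_cons_cons,
          List.getLast?_singleton, Alternating]; tauto
      | cons d l => simp only [List.getLast?_cons_cons]; tauto

theorem Alternating.of_append_left {l l' : History M V Tid Id} (h : Alternating (l ++ l')) :
    Alternating l := by
  induction l' using List.reverseRecOn with
  | nil => simpa using h
  | append_singleton l' b ih =>
    rw [← List.append_assoc, alternating_concat] at h
    exact ih h.1

/-- In an alternating history every response directly follows a matching invocation. -/
theorem Alternating.exists_inv {l : History M V Tid Id} (h : Alternating l)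
    {A B : History M V Tid Id} {r : Action M V Tid Id} (hl : l = A ++ r :: B) (hr : r.IsRes) :
    ∃ A' a, A = A' ++ [a] ∧ a.IsInv ∧ a.method = r.method ∧ a.key = r.key := by
  subst hl
  have h1 : Alternating (A ++ [r]) := by
    apply Alternating.of_append_left (l' := B); simpa using h
  rw [alternating_concat] at h1
  rcases List.eq_nil_or_concat A with rfl | ⟨A', a, rfl⟩
  · exact absurd hr (not_isRes_of_isInv h1.2)
  · refine ⟨A', a, by simp, ?_⟩
    have h2 := h1.2
    simp only [List.concat_eq_append, List.getLast?_concat, CanFollow] at h2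
    rcases h2 with h2 | h2
    · exact absurd hr (not_isRes_of_isInv h2.2)
    · exact ⟨h2.1, h2.2.2.1, by simp [Action.key, h2.2.2.2]⟩

theorem restrictTid_append (h h' : History M V Tid Id) (p : Tid) :
    restrictTid (h ++ h') p = restrictTid h p ++ restrictTid h' p := by
  simp [restrictTid]

@[simp]
theorem restrictTid_nil (p : Tid) : restrictTid ([] : History M V Tid Id) p = [] := rfl

theorem restrictTid_singleton_self (b : Action M V Tid Id) : restrictTid [b] b.tid = [b] := by
  simp [restrictTid]

theorem restrictTid_singleton_of_eq {b : Action M V Tid Id} {p : Tid} (hp : b.tid = p) :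
    restrictTid [b] p = [b] := by
  simp [restrictTid, hp]

theorem restrictTid_singleton_of_ne {b : Action M V Tid Id} {p : Tid} (hp : b.tid ≠ p) :
    restrictTid [b] p = [] := by
  simp [restrictTid, hp]

theorem mem_restrictTid {h : History M V Tid Id} {p : Tid} {a : Action M V Tid Id} :
    a ∈ restrictTid h p ↔ a ∈ h ∧ a.tid = p := by
  simp [restrictTid]

theorem mem_completed {h : History M V Tid Id} {a : Action M V Tid Id} :
    a ∈ completed h ↔ a ∈ h ∧ CompletedOp h a.key := by
  simp [completed]

theorem mem_invKeys {h : History M V Tid Id} {o : Tid × Id} :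
    o ∈ h.filterMap Action.invKey? ↔ ∃ a ∈ h, a.IsInv ∧ a.key = o := by
  simp only [List.mem_filterMap]
  constructor
  · rintro ⟨a, ha, e⟩
    cases a with
    | inv m v p k => exact ⟨_, ha, trivial, Option.some.inj e⟩
    | res m v p k => exact absurd e (by simp [Action.invKey?])
  · rintro ⟨a, ha, hi, e⟩
    refine ⟨a, ha, ?_⟩
    cases a <;> simp_all [Action.invKey?, Action.key, Action.IsInv, Action.tid, Action.id]

theorem invKey?_of_isInv {a : Action M V Tid Id} (ha : a.IsInv) : a.invKey? = some a.key := by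
  cases a <;> simp_all [Action.invKey?, Action.key, Action.IsInv, Action.tid, Action.id]

theorem invKey?_of_isRes {a : Action M V Tid Id} (ha : a.IsRes) : a.invKey? = none := by
  cases a <;> simp_all [Action.invKey?, Action.IsRes]

/-- If the invocations carry distinct identifiers, then each of them splits the history uniquely. -/
theorem inv_split_unique {A B A' B' : History M V Tid Id} {i j : Action M V Tid Id}
    (hn : ((A ++ i :: B).filterMap Action.invKey?).Nodup) (he : A ++ i :: B = A' ++ j :: B')
    (hi : i.IsInv) (hj : j.IsInv) (hk : i.key = j.key) : A = A' ∧ i = j ∧ B = B' := by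
  induction A generalizing A' with
  | nil =>
    cases A' with
    | nil => simpa using he
    | cons c A' =>
      simp only [List.nil_append, List.cons_append, List.cons.injEq] at he hn
      obtain ⟨rfl, rfl⟩ := he
      rw [List.filterMap_cons_some (invKey?_of_isInv hi), List.nodup_cons] at hn
      exact absurd (mem_invKeys.2 ⟨j, by simp, hj, hk.symm⟩) hn.1
  | cons c A ih =>
    cases A' with
    | nil =>
      simp only [List.nil_append, List.cons_append, List.cons.injEq] at he hn
      obtain ⟨rfl, rfl⟩ := he
      rw [List.filterMap_cons_some (invKey?_of_isInv hj), List.nodup_cons] at hn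
      exact absurd (mem_invKeys.2 ⟨i, by simp, hi, hk⟩) hn.1
    | cons c' A' =>
      simp only [List.cons_append, List.cons.injEq] at he hn
      obtain ⟨rfl, he⟩ := he
      have hn' : ((A ++ i :: B).filterMap Action.invKey?).Nodup := by
        exact List.Nodup.sublist ((List.sublist_cons_self _ _).filterMap _) hn
      have := ih hn' he
      simpa using this

theorem inv_eq_of_key_eq {h : History M V Tid Id} (hn : (h.filterMap Action.invKey?).Nodup)
    {i j : Action M V Tid Id} (hi : i ∈ h) (hj : j ∈ h) (hi' : i.IsInv) (hj' : j.IsInv)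
    (hk : i.key = j.key) : i = j := by
  obtain ⟨A, B, rfl⟩ := List.append_of_mem hi
  obtain ⟨A', B', e⟩ := List.append_of_mem hj
  exact (inv_split_unique hn e hi' hj' hk).2.1

theorem Sequential.of_append_left {l l' : History M V Tid Id} (h : Sequential (l ++ l')) :
    Sequential l :=
  ⟨h.1.of_append_left, by
    have := h.2
    rw [List.filterMap_append] at this
    exact this.of_append_left⟩

theorem WellFormed.of_append_left {l l' : History M V Tid Id} (h : WellFormed (l ++ l')) :
    WellFormed l := fun p => by
  have := h p
  rw [restrictTid_append] at this
  exact this.of_append_left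

/-- A well-formed history carries distinct identifiers on its invocations. -/
theorem WellFormed.nodup {h : History M V Tid Id} (hw : WellFormed h) :
    (h.filterMap Action.invKey?).Nodup := by
  induction h using List.reverseRecOn with
  | nil => simp
  | append_singleton h b ih =>
    have hh := ih hw.of_append_left
    rcases isInv_or_isRes b with hb | hb
    · rw [List.filterMap_append, List.filterMap_cons_some (invKey?_of_isInv hb)]
      have h1 := (hw b.tid).2
      rw [restrictTid_append, restrictTid_singleton_self, List.filterMap_append,
        List.filterMap_cons_some (invKey?_of_isInv hb)] at h1
      simp only [List.filterMap_nil] at h1 ⊢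
      rw [List.nodup_append] at h1 ⊢
      refine ⟨hh, by simp, ?_⟩
      rintro o ho o' ho' rfl
      simp only [List.mem_singleton] at ho'
      obtain ⟨a, ha, hi, hk⟩ := mem_invKeys.1 ho
      refine h1.2.2 o (mem_invKeys.2 ⟨a, mem_restrictTid.2 ⟨ha, ?_⟩, hi, hk⟩) b.key (by simp) ho'
      rw [ho'] at hk
      simpa [Action.key] using (Prod.ext_iff.1 hk).1
    · rw [List.filterMap_append, List.filterMap_cons_none (invKey?_of_isRes hb)]
      simpa using hh

theorem pair_sublist_concat {α : Type*} {l : List α} {a b c : α}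
    (h : List.Sublist [a, b] (l ++ [c])) :
    List.Sublist [a, b] l ∨ (a ∈ l ∧ b = c) := by
  obtain ⟨l₁, l₂, e, h₁, h₂⟩ := List.sublist_append_iff.1 h
  match l₁, e with
  | [], e =>
    simp only [List.nil_append] at e
    subst e
    exact absurd h₂.length_le (by simp)
  | [_], e =>
    simp only [List.cons_append, List.nil_append, List.cons.injEq] at e
    obtain ⟨rfl, rfl⟩ := e
    exact Or.inr ⟨by simpa using h₁, by simpa using h₂⟩
  | [_, _], e =>
    simp only [List.cons_append, List.nil_append, List.cons.injEq] at e
    obtain ⟨rfl, rfl, -⟩ := e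
    exact Or.inl h₁
  | _ :: _ :: _ :: _, e => simp at e

theorem pair_sublist_of_not_mem {α : Type*} {l l' : List α} {a b : α}
    (h : List.Sublist [a, b] (l ++ l')) (hb : b ∉ l') : List.Sublist [a, b] l := by
  induction l' using List.reverseRecOn with
  | nil => simpa using h
  | append_singleton l' c ih =>
    rw [← List.append_assoc] at h
    simp only [List.mem_append, List.mem_singleton, not_or] at hb
    rcases pair_sublist_concat h with h | h
    · exact ih h hb.1
    · exact absurd h.2 hb.2

theorem pair_sublist_of_mem {α : Type*} {l l' : List α} {a b : α} (ha : a ∈ l) (hb : b ∈ l') :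
    List.Sublist [a, b] (l ++ l') :=
  List.Sublist.append (l₁ := [a]) (r₁ := [b]) (by simpa using ha) (by simpa using hb)

end History

/-! ### Building a linearization move by move -/

namespace History

variable {M : Type*} {V : Type*} {Tid : Type*} {Id : Type*}

/-- The phase of a thread while a linearization is being built: it is idle, or its pending
operation has not been linearized yet, or it has been, with the given response. -/
inductive Phase (M : Type*) (V : Type*) (Tid : Type*) (Id : Type*)
  | idle
  | pending (i : Action M V Tid Id)
  | done (r : Action M V Tid Id)

namespace Phase

def pend : Phase M V Tid Id → History M V Tid Id
  | pending i => [i]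
  | _ => []

def resp : Phase M V Tid Id → History M V Tid Id
  | done r => [r]
  | _ => []

end Phase

/-- `s` is the sequence of the operations linearized so far in the history `h`, and `φ` records
the phases of the threads. -/
structure Linearizing (h s : History M V Tid Id) (φ : Tid → Phase M V Tid Id) : Prop where
  nodup : (h.filterMap Action.invKey?).Nodup
  pend : ∀ p, ∀ a ∈ (φ p).pend, a.IsInv ∧ a.tid = p
  resp : ∀ p, ∀ a ∈ (φ p).resp, a.IsRes ∧ a.tid = p
  full : ∀ p, restrictTid h p ++ (φ p).resp = restrictTid s p ++ (φ p).pend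
  alt : ∀ p, Alternating (restrictTid s p ++ (φ p).pend)
  last : ∀ p a, (restrictTid s p).getLast? = some a → a.IsRes
  altSeq : Alternating s
  lastSeq : ∀ a, s.getLast? = some a → a.IsRes
  nodupSeq : (s.filterMap Action.invKey?).Nodup
  realTime : ∀ r i : Action M V Tid Id, r.IsRes → i.IsInv → List.Sublist [r, i] h → i ∈ s →
    List.Sublist [r, i] s

namespace Linearizing

variable {h s : History M V Tid Id} {φ : Tid → Phase M V Tid Id}

theorem nil : Linearizing ([] : History M V Tid Id) [] (fun _ => .idle) where
  nodup := by simp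
  pend := by simp [Phase.pend]
  resp := by simp [Phase.resp]
  full := by simp [Phase.pend, Phase.resp]
  alt := by simp [Phase.pend, Alternating]
  last := by simp
  altSeq := by simp [Alternating]
  lastSeq := by simp
  nodupSeq := by simp
  realTime := by simp

theorem mem_of_isInv (H : Linearizing h s φ) {a : Action M V Tid Id} (ha : a ∈ s) (hi : a.IsInv) :
    a ∈ h := by
  have h1 : a ∈ restrictTid h a.tid ++ (φ a.tid).resp := by
    rw [H.full]
    exact List.mem_append_left _ (mem_restrictTid.2 ⟨ha, rfl⟩)
  rcases List.mem_append.1 h1 with h1 | h1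
  · exact (mem_restrictTid.1 h1).1
  · exact absurd (H.resp _ _ h1).1 (not_isRes_of_isInv hi)

theorem mem_of_isRes (H : Linearizing h s φ) {a : Action M V Tid Id} (ha : a ∈ h) (hr : a.IsRes) :
    a ∈ s := by
  have h1 : a ∈ restrictTid s a.tid ++ (φ a.tid).pend := by
    rw [← H.full]
    exact List.mem_append_left _ (mem_restrictTid.2 ⟨ha, rfl⟩)
  rcases List.mem_append.1 h1 with h1 | h1
  · exact (mem_restrictTid.1 h1).1
  · exact absurd hr (not_isRes_of_isInv (H.pend _ _ h1).1)

open Classical in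
-- Real-time order survives because the new invocation has fresh identifiers and so cannot already
-- be in `s`.
theorem inv (H : Linearizing h s φ) {b : Action M V Tid Id} (hb : b.IsInv)
    (hφ : φ b.tid = .idle) (hk : b.key ∉ h.filterMap Action.invKey?) :
    Linearizing (h ++ [b]) s (Function.update φ b.tid (.pending b)) where
  nodup := by
    rw [List.filterMap_append, List.filterMap_cons_some (invKey?_of_isInv hb), List.nodup_append]
    exact ⟨H.nodup, by simp, by
      rintro o ho o' ho' rfl
      simp only [List.filterMap_nil, List.mem_singleton] at ho'
      exact hk (ho' ▸ ho)⟩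
  pend p := by
    by_cases hp : p = b.tid
    · subst hp; simp [Phase.pend, hb]
    · simpa [hp] using H.pend p
  resp p := by
    by_cases hp : p = b.tid
    · subst hp; simp [Phase.resp]
    · simpa [hp] using H.resp p
  full p := by
    have := H.full p
    by_cases hp : p = b.tid
    · subst hp
      simp only [hφ, Phase.resp, Phase.pend, List.append_nil] at this
      simp [restrictTid_append, restrictTid_singleton_self, Phase.resp, Phase.pend, this]
    · simpa [hp, restrictTid_append, restrictTid_singleton_of_ne (Ne.symm hp)] using this
  alt p := by
    by_cases hp : p = b.tid
    · subst hp
      have h1 := H.alt b.tid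
      simp only [hφ, Phase.pend, List.append_nil] at h1
      simp only [Function.update_self, Phase.pend, alternating_concat, h1, true_and]
      cases e : (restrictTid s b.tid).getLast? with
      | none => exact hb
      | some a => exact Or.inl ⟨H.last _ _ e, hb⟩
    · simpa [hp] using H.alt p
  last := H.last
  altSeq := H.altSeq
  lastSeq := H.lastSeq
  nodupSeq := H.nodupSeq
  realTime r i hr hi hs his := by
    rcases pair_sublist_concat hs with hs | ⟨-, rfl⟩
    · exact H.realTime r i hr hi hs his
    · exact absurd (mem_invKeys.2 ⟨i, H.mem_of_isInv his hi, hi, rfl⟩) hk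

open Classical in
-- The operation takes effect now, with response `r`, possibly before it answers in `h`. Putting it
-- at the end of `s` respects real time since every response in `h` already lies in `s`.
theorem lin (H : Linearizing h s φ) {p : Tid} {i r : Action M V Tid Id} (hφ : φ p = .pending i)
    (hr : r.IsRes) (hm : i.method = r.method) (hkey : i.key = r.key) :
    Linearizing h (s ++ [i, r]) (Function.update φ p (.done r)) := by
  have hi : i.IsInv ∧ i.tid = p := H.pend p i (by simp [hφ, Phase.pend])
  obtain ⟨hi, rfl⟩ := hi
  have ht : i.tid = r.tid := congrArg Prod.fst hkey
  have hd : i.id = r.id := congrArg Prod.snd hkey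
  have hfull := H.full i.tid
  simp only [hφ, Phase.resp, Phase.pend, List.append_nil] at hfull
  have hih : i ∈ h := by
    have : i ∈ restrictTid h i.tid := by rw [hfull]; simp
    exact (mem_restrictTid.1 this).1
  have hrest : restrictTid (s ++ [i, r]) i.tid = restrictTid s i.tid ++ [i] ++ [r] := by
    rw [← List.singleton_append (x := i), restrictTid_append, restrictTid_append,
      restrictTid_singleton_self, restrictTid_singleton_of_eq ht.symm, List.append_assoc]
  have hrest' : ∀ q, q ≠ i.tid → restrictTid (s ++ [i, r]) q = restrictTid s q := by
    intro q hq
    rw [← List.singleton_append (x := i), restrictTid_append, restrictTid_append,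
      restrictTid_singleton_of_ne hq.symm, restrictTid_singleton_of_ne (ht ▸ hq.symm),
      List.append_nil, List.append_nil]
  have hnk : i.key ∉ s.filterMap Action.invKey? := by
    intro hmem
    obtain ⟨j, hj, hji, hjk⟩ := mem_invKeys.1 hmem
    have hjh := H.mem_of_isInv hj hji
    have hjt : j.tid = i.tid := congrArg Prod.fst hjk
    have h1 : ((restrictTid h i.tid).filterMap Action.invKey?).Nodup :=
      List.Nodup.sublist (List.Sublist.filterMap _ List.filter_sublist) H.nodup
    rw [hfull, List.filterMap_append, List.filterMap_cons_some (invKey?_of_isInv hi),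
      List.nodup_append] at h1
    exact h1.2.2 _ (mem_invKeys.2 ⟨j, mem_restrictTid.2 ⟨hj, hjt⟩, hji, hjk⟩) i.key (by simp) rfl
  refine ⟨H.nodup, fun p => ?_, fun p => ?_, fun p => ?_, fun p => ?_,
    fun p a ha => ?_, ?_, ?_, ?_, ?_⟩
  · by_cases hp : p = i.tid
    · subst hp; simp [Phase.pend]
    · simpa [hp] using H.pend p
  · by_cases hp : p = i.tid
    · subst hp; simp [Phase.resp, hr, ht]
    · simpa [hp] using H.resp p
  · by_cases hp : p = i.tid
    · subst hp; rw [hrest, hfull]; simp [Phase.resp, Phase.pend]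
    · rw [hrest' p hp]; simpa [hp] using H.full p
  · by_cases hp : p = i.tid
    · subst hp
      have h1 := H.alt i.tid
      simp only [hφ, Phase.pend] at h1
      rw [hrest]
      simp only [Function.update_self, Phase.pend, List.append_nil, alternating_concat _ r,
        List.getLast?_concat]
      exact ⟨h1, Or.inr ⟨hi, hr, hm, ht, hd⟩⟩
    · rw [hrest' p hp]; simpa [hp] using H.alt p
  · by_cases hp : p = i.tid
    · subst hp
      rw [hrest, List.getLast?_concat] at ha
      exact Option.some.inj ha ▸ hr
    · rw [hrest' p hp] at ha; exact H.last p a ha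
  · rw [← List.singleton_append (x := i), ← List.append_assoc, alternating_concat,
      alternating_concat, List.getLast?_concat]
    refine ⟨⟨H.altSeq, ?_⟩, Or.inr ⟨hi, hr, hm, ht, hd⟩⟩
    cases e : s.getLast? with
    | none => exact hi
    | some a => exact Or.inl ⟨H.lastSeq _ e, hi⟩
  · intro a ha
    rw [← List.singleton_append (x := i), ← List.append_assoc, List.getLast?_concat] at ha
    exact Option.some.inj ha ▸ hr
  · rw [List.filterMap_append, List.filterMap_cons_some (invKey?_of_isInv hi),
      List.filterMap_cons_none (invKey?_of_isRes hr), List.nodup_append]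
    refine ⟨H.nodupSeq, by simp, ?_⟩
    rintro o ho o' ho' rfl
    simp only [List.filterMap_nil, List.mem_singleton] at ho'
    exact hnk (ho' ▸ ho)
  · intro r' j hr' hj hs hjs
    rcases List.mem_append.1 hjs with hjs | hjs
    · exact (H.realTime r' j hr' hj hs hjs).trans (List.sublist_append_left _ _)
    · apply pair_sublist_of_mem _ hjs
      exact H.mem_of_isRes (hs.subset (by simp)) hr'

open Classical in
-- The response was fixed when the operation was linearized, so `s` does not change.
theorem res (H : Linearizing h s φ) {p : Tid} {r : Action M V Tid Id} (hφ : φ p = .done r) :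
    Linearizing (h ++ [r]) s (Function.update φ p .idle) := by
  have hr : r.IsRes ∧ r.tid = p := H.resp p r (by simp [hφ, Phase.resp])
  obtain ⟨hr, rfl⟩ := hr
  refine ⟨?_, fun p => ?_, fun p => ?_, fun p => ?_, fun p => ?_, H.last, H.altSeq, H.lastSeq,
    H.nodupSeq, ?_⟩
  · rw [List.filterMap_append, List.filterMap_cons_none (invKey?_of_isRes hr)]
    simpa using H.nodup
  · by_cases hp : p = r.tid
    · subst hp; simp [Phase.pend]
    · simpa [hp] using H.pend p
  · by_cases hp : p = r.tid
    · subst hp; simp [Phase.resp]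
    · simpa [hp] using H.resp p
  · have := H.full p
    by_cases hp : p = r.tid
    · subst hp
      simp only [hφ, Phase.resp, Phase.pend, List.append_nil] at this
      simp [restrictTid_append, restrictTid_singleton_self, Phase.resp, Phase.pend, this]
    · simpa [hp, restrictTid_append, restrictTid_singleton_of_ne (Ne.symm hp)] using this
  · have := H.alt p
    by_cases hp : p = r.tid
    · subst hp
      simp only [hφ, Phase.pend, List.append_nil] at this
      simpa [Phase.pend] using this
    · simpa [hp] using this
  · intro r' i hr' hi hs his
    rcases pair_sublist_concat hs with hs | ⟨-, rfl⟩
    · exact H.realTime r' i hr' hi hs his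
    · exact absurd hr (not_isRes_of_isInv hi)

theorem wellFormed (H : Linearizing h s φ) : WellFormed h := fun p => by
  refine ⟨?_, List.Nodup.sublist (List.Sublist.filterMap _ List.filter_sublist) H.nodup⟩
  have := H.alt p
  rw [← H.full p] at this
  exact this.of_append_left

theorem sequential (H : Linearizing h s φ) : Sequential s := ⟨H.altSeq, H.nodupSeq⟩

open Classical in
theorem restrictTid_flatMap {l : List Tid} (hl : l.Nodup) (f : Tid → History M V Tid Id)
    (hf : ∀ p, ∀ a ∈ f p, a.tid = p) (p : Tid) :
    restrictTid (l.flatMap f) p = if p ∈ l then f p else [] := by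
  induction l with
  | nil => simp
  | cons q l ih =>
    rw [List.nodup_cons] at hl
    rw [List.flatMap_cons, restrictTid_append, ih hl.2]
    by_cases hq : q = p
    · subst hq
      have h1 : restrictTid (f q) q = f q := List.filter_eq_self.2 (by simpa using hf q)
      simp [hl.1, h1]
    · have h1 : restrictTid (f q) p = [] :=
        List.filter_eq_nil_iff.2 (fun a ha => by simpa [hf q a ha] using hq)
      simp [h1, Ne.symm hq]

theorem isLinearization (H : Linearizing h s φ) : IsLinearization h s := by
  classical
  refine ⟨H.sequential, ?_⟩
  -- The responses still owed to linearized operations. `Tid` may be infinite, so the threads are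
  -- taken from `s`; a thread in phase `done` occurs there, because `full` puts its response into
  -- `s`.
  set rs : History M V Tid Id := (s.map Action.tid).dedup.flatMap fun p => (φ p).resp with hrs
  have hres : ∀ a ∈ rs, a.IsRes := by
    intro a ha
    obtain ⟨p, -, hp⟩ := List.mem_flatMap.1 ha
    exact (H.resp p a hp).1
  have hrsp : ∀ p, restrictTid rs p = (φ p).resp := by
    intro p
    rw [hrs, restrictTid_flatMap (List.nodup_dedup _) _ (fun p a ha => (H.resp p a ha).2)]
    split_ifs with hp
    · rfl
    · cases e : φ p with
      | idle => rfl
      | pending => rfl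
      | done r =>
        exfalso
        apply hp
        have h1 : r ∈ restrictTid s p := by
          have h2 := H.full p
          simp only [e, Phase.resp, Phase.pend, List.append_nil] at h2
          rw [← h2]; simp
        rw [List.mem_dedup]
        exact List.mem_map.2 ⟨r, mem_restrictTid.1 h1⟩
  have hfull : ∀ p, restrictTid (h ++ rs) p = restrictTid s p ++ (φ p).pend := by
    intro p
    rw [restrictTid_append, hrsp, H.full]
  have hfm : rs.filterMap Action.invKey? = [] :=
    List.filterMap_eq_nil_iff.2 fun a ha => invKey?_of_isRes (hres a ha)
  have hnod : ((h ++ rs).filterMap Action.invKey?).Nodup := by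
    rw [List.filterMap_append, hfm, List.append_nil]; exact H.nodup
  have hwf : WellFormed (h ++ rs) := fun p => by
    refine ⟨?_, List.Nodup.sublist (List.Sublist.filterMap _ List.filter_sublist) hnod⟩
    rw [hfull]; exact H.alt p
  have hmem : ∀ a ∈ s, a ∈ h ++ rs := fun a ha => by
    have : a ∈ restrictTid (h ++ rs) a.tid := by
      rw [hfull]; exact List.mem_append_left _ (mem_restrictTid.2 ⟨ha, rfl⟩)
    exact (mem_restrictTid.1 this).1
  have hmem' : ∀ a ∈ h ++ rs, a.IsRes → a ∈ s := fun a ha hr => by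
    have : a ∈ restrictTid (h ++ rs) a.tid := mem_restrictTid.2 ⟨ha, rfl⟩
    rw [hfull] at this
    rcases List.mem_append.1 this with h1 | h1
    · exact (mem_restrictTid.1 h1).1
    · exact absurd hr (not_isRes_of_isInv (H.pend _ _ h1).1)
  have hinvof : ∀ a ∈ s, a.IsRes → ∃ i ∈ s, i.IsInv ∧ i.key = a.key := fun a ha hr => by
    obtain ⟨A, B, hAB⟩ := List.append_of_mem ha
    obtain ⟨A', i, rfl, hi, -, hk⟩ := H.altSeq.exists_inv hAB hr
    exact ⟨i, by rw [hAB]; simp, hi, hk⟩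
  have hresof : ∀ (l : History M V Tid Id), Alternating l → (∀ a, l.getLast? = some a → a.IsRes) →
      ∀ i ∈ l, i.IsInv → ∃ r ∈ l, r.IsRes ∧ r.key = i.key := by
    intro l hl hlast i hi hii
    obtain ⟨A, B, rfl⟩ := List.append_of_mem hi
    cases B with
    | nil => exact absurd (hlast i (by simp)) (not_isRes_of_isInv hii)
    | cons b B =>
      have h1 : Alternating (A ++ [i] ++ [b]) := by
        apply Alternating.of_append_left (l' := B); simpa using hl
      rw [alternating_concat, List.getLast?_concat] at h1
      rcases h1.2 with h1 | h1
      · exact absurd h1.1 (not_isRes_of_isInv hii)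
      · exact ⟨b, by simp, h1.2.1, by simp [Action.key, h1.2.2.2]⟩
  have hcomp : ∀ a ∈ s, CompletedOp (h ++ rs) a.key := by
    intro a ha
    rcases isInv_or_isRes a with hi | hr
    · obtain ⟨r, hr, hr', hk⟩ := hresof s H.altSeq H.lastSeq a ha hi
      exact ⟨⟨a, hmem a ha, hi, rfl⟩, ⟨r, hmem r hr, hr', hk⟩⟩
    · obtain ⟨i, hi, hi', hk⟩ := hinvof a ha hr
      exact ⟨⟨i, hmem i hi, hi', hk⟩, ⟨a, hmem a ha, hr, rfl⟩⟩
  have hcomp' : ∀ a ∈ h ++ rs, CompletedOp (h ++ rs) a.key → a ∈ s := by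
    intro a ha hc
    rcases isInv_or_isRes a with hi | hr
    · obtain ⟨-, r, hr, hr', hk⟩ := hc
      obtain ⟨i, hi', hi'', hk'⟩ := hinvof r (hmem' r hr hr') hr'
      have := inv_eq_of_key_eq hnod ha (hmem i hi') hi hi'' (by rw [hk', hk])
      exact this ▸ hi'
    · exact hmem' a ha hr
  refine ⟨rs, hres, hwf, fun p => ?_, ?_⟩
  · have h1 : restrictTid (completed (h ++ rs)) p
        = (restrictTid (h ++ rs) p).filter fun a => CompletedOp (h ++ rs) a.key := by
      rw [restrictTid, completed, List.filter_filter, restrictTid, List.filter_filter]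
      simp only [Bool.and_comm]
    rw [h1, hfull, List.filter_append, List.filter_eq_self.2, List.filter_eq_nil_iff.2,
      List.append_nil]
    -- A pending invocation that is not linearized is dropped: were its operation completed, it
    -- would also lie in `s`, and its identifiers would occur twice in its thread.
    · intro a ha hc
      have hai := H.pend p a ha
      have ham : a ∈ restrictTid (h ++ rs) p := by rw [hfull]; exact List.mem_append_right _ ha
      have has := hcomp' a (mem_restrictTid.1 ham).1 (by simpa using hc)
      have h2 := (hwf p).2
      rw [hfull, List.filterMap_append, List.nodup_append] at h2
      exact h2.2.2 a.key (mem_invKeys.2 ⟨a, mem_restrictTid.2 ⟨has, hai.2⟩, hai.1, rfl⟩) a.key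
        (mem_invKeys.2 ⟨a, ha, hai.1, rfl⟩) rfl
    · intro a ha
      simpa using hcomp a (mem_restrictTid.1 ha).1
  · rintro o₁ o₂ ⟨r, i, hr, hrk, hi, hik, hs⟩
    refine ⟨r, i, hr, hrk, hi, hik, ?_⟩
    have hs' : List.Sublist [r, i] (h ++ rs) := hs.trans List.filter_sublist
    have him : i ∈ completed (h ++ rs) := hs.subset (by simp)
    rw [mem_completed] at him
    refine H.realTime r i hr hi (pair_sublist_of_not_mem hs' ?_) (hcomp' i him.1 him.2)
    intro hmem
    exact absurd (hres i hmem) (not_isRes_of_isInv hi)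

end Linearizing

end History

/-! ### Paths, their targets and external labels -/

namespace LTS

variable {Q : Type*} {Λ : Type*} {A : LTS Q Λ}

/-- The state in which a sequence of transitions that starts in `q` ends. -/
def target (q : Q) (ts : List A.Transition) : Q :=
  (ts.getLast?).elim q Transition.post

@[simp]
theorem target_nil (q : Q) : target q ([] : List A.Transition) = q := rfl

@[simp]
theorem target_concat (q : Q) (ts : List A.Transition) (t : A.Transition) :
    target q (ts ++ [t]) = t.post := by
  simp [target]

theorem target_cons (q : Q) (t : A.Transition) (ts : List A.Transition) :
    target q (t :: ts) = target t.post ts := by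
  cases ts with
  | nil => rfl
  | cons c ts => simp [target, List.getLast?_cons]

theorem target_append (q : Q) (ts ts' : List A.Transition) :
    target q (ts ++ ts') = target (target q ts) ts' := by
  induction ts generalizing q with
  | nil => rfl
  | cons t ts ih => rw [List.cons_append, target_cons, ih, target_cons]

theorem isPath_append (ts ts' : List A.Transition) (q : Q) :
    A.IsPath q (ts ++ ts') ↔ A.IsPath q ts ∧ A.IsPath (target q ts) ts' := by
  induction ts generalizing q with
  | nil => simp [IsPath]
  | cons t ts ih =>
    simp [IsPath, ih, target_cons, and_assoc]

theorem isPath_concat (ts : List A.Transition) (t : A.Transition) (q : Q) :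
    A.IsPath q (ts ++ [t]) ↔ A.IsPath q ts ∧ t.pre = target q ts := by
  simp [isPath_append, IsPath]

theorem Steps.trans {q q' q'' : Q} {ρ ρ' : List Λ} (h : A.Steps q ρ q') (h' : A.Steps q' ρ' q'') :
    A.Steps q (ρ ++ ρ') q'' := by
  induction h with
  | nil => exact h'
  | cons hl _ ih => exact .cons hl (ih h')

end LTS

@[simp]
theorem external_append {Act ι : Type*} (ρ ρ' : List (Act ⊕ ι)) :
    external (ρ ++ ρ') = external ρ ++ external ρ' := by
  simp [external]

@[simp]
theorem external_nil {Act ι : Type*} : external ([] : List (Act ⊕ ι)) = [] := rfl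

@[simp]
theorem external_cons_inl {Act ι : Type*} (a : Act) (ρ : List (Act ⊕ ι)) :
    external (Sum.inl a :: ρ) = a :: external ρ := rfl

@[simp]
theorem external_cons_inr {Act ι : Type*} (i : ι) (ρ : List (Act ⊕ ι)) :
    external (Sum.inr i :: ρ) = external ρ := rfl

/-! ### `WSR` is write strongly-linearizable -/

namespace WSR

open History

variable {Tid : Type*} {Id : Type*}

open Classical in
/-- The value that the pending read of thread `p` is going to pick. -/
noncomputable def pick (p : Tid) : List (WSR Tid Id).Transition → Option ℕ
  | [] => none
  | t :: ts =>
      if t.label = Sum.inr p ∧ t.post.pc p = .rEnd then some (t.post.arg p) else pick p ts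

/-- The completed write operation that thread `p` performs in state `q`. -/
def writeOp (q : State Tid Id) (p : Tid) : RegHistory Tid Id :=
  ((q.ids p).getLast?).elim [] fun k =>
    [.inv .write (some (q.arg p)) p k, .res .write none p k]

open Classical in
/-- The write operation, if any, that takes effect in a transition. -/
noncomputable def effect (t : (WSR Tid Id).Transition) : RegHistory Tid Id :=
  match t.label with
  | Sum.inl _ => []
  | Sum.inr p => if t.pre.pc p = .wBegin then writeOp t.pre p else []

/-- The phase of the linearization process fits the state of thread `p`, where `n?` is the value
that the pending read of `p` is going to pick. -/
def Fits (q : State Tid Id) (p : Tid) (n? : Option ℕ) (f : Phase RegMethod ℕ Tid Id) : Prop :=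
  match q.pc p with
  | .main => f = .idle
  | .wBegin => ∃ k, (q.ids p).getLast? = some k ∧ f = .pending (.inv .write (some (q.arg p)) p k)
  | .wEnd => ∃ k, (q.ids p).getLast? = some k ∧ f = .done (.res .write none p k)
  | .rBegin => ∃ k, (q.ids p).getLast? = some k ∧ f = .pending (.inv .read none p k)
  | .rLoop => ∃ k, (q.ids p).getLast? = some k ∧
      ((f = .pending (.inv .read none p k) ∧ ∀ n ∈ q.vs p, n? ≠ some n) ∨
        ∃ n, n? = some n ∧ f = .done (.res .read (some n) p k))
  | .rEnd => ∃ k, (q.ids p).getLast? = some k ∧ f = .done (.res .read (some (q.arg p)) p k)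

/-- Here `h` and `s` belong to the past, whereas `ts` are the transitions still to come, which
decide what each pending read picks. `fresh` turns the identifier check of `WSR` into freshness with
respect to `h`. -/
structure Consistent (q : State Tid Id) (ts : List (WSR Tid Id).Transition)
    (h s : RegHistory Tid Id) (φ : Tid → Phase RegMethod ℕ Tid Id) : Prop where
  lin : Linearizing h s φ
  fits : ∀ p, Fits q p (pick p ts) (φ p)
  fresh : ∀ p k, (p, k) ∈ h.filterMap Action.invKey? → k ∈ q.ids p

theorem Fits.congr {q q' : State Tid Id} {p : Tid} {n? : Option ℕ} {f : Phase RegMethod ℕ Tid Id}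
    (h : Fits q p n? f) (hpc : q'.pc p = q.pc p) (hids : q'.ids p = q.ids p)
    (hvs : q'.vs p = q.vs p) (harg : q'.arg p = q.arg p) : Fits q' p n? f := by
  simpa [Fits, hpc, hids, hvs, harg] using h

theorem pick_cons_of_label_inl {t : (WSR Tid Id).Transition} {a : RegAction Tid Id}
    (h : t.label = Sum.inl a) (p : Tid) (ts : List (WSR Tid Id).Transition) :
    pick p (t :: ts) = pick p ts := by
  simp [pick, h]

theorem pick_cons_of_label_ne {t : (WSR Tid Id).Transition} {p q : Tid}
    (h : t.label = Sum.inr q) (hp : p ≠ q) (ts : List (WSR Tid Id).Transition) :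
    pick p (t :: ts) = pick p ts := by
  simp [pick, h, Ne.symm hp]

/-- A single transition extends the linearization by a legal sequence of operations whose writes
are those that take effect in the transition. -/
theorem Consistent.step {t : (WSR Tid Id).Transition} {ts : List (WSR Tid Id).Transition}
    {h s : RegHistory Tid Id} {φ : Tid → Phase RegMethod ℕ Tid Id}
    (H : Consistent t.pre (t :: ts) h s φ) :
    ∃ s' φ', Consistent t.post ts (h ++ external [t.label]) (s ++ s') φ' ∧
      restrictMethod s' .write = effect t ∧
      ∀ s'', RegLegal t.post.val s'' → RegLegal t.pre.val (s' ++ s'') := by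
  classical
  obtain ⟨hlin, hfits, hfresh⟩ := H
  obtain ⟨q, l, q', hv⟩ := t
  have hv' : Step q l q' := hv
  dsimp only at hfits hfresh ⊢
  cases hv' with
  | readInv p k hpc hk =>
    have hp := hfits p
    simp only [Fits, hpc] at hp
    have hlin' := hlin.inv (b := .inv .read none p k) trivial hp (fun hm => hk (hfresh p k hm))
    refine ⟨[], _, ⟨by rw [List.append_nil]; exact hlin', fun p' => ?_, fun p' k' hm => ?_⟩, rfl,
      fun s'' hs => hs⟩
    · have := hfits p'
      rw [pick_cons_of_label_inl rfl] at this
      by_cases hpp : p' = p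
      · subst hpp; simp [Fits, Action.tid]
      · simp only [Action.tid, Function.update_of_ne hpp]
        exact this.congr (by simp [hpp]) (by simp [hpp]) rfl rfl
    · simp only [external_cons_inl, external_nil, List.filterMap_append, List.mem_append] at hm
      by_cases hpp : p' = p
      · subst hpp
        rcases hm with hm | hm
        · simp [hfresh _ _ hm]
        · simp [Action.invKey?] at hm; simp [hm]
      · rcases hm with hm | hm
        · simp [hpp, hfresh _ _ hm]
        · simp [Action.invKey?, hpp] at hm
  | writeInv p k n hpc hk =>
    have hp := hfits p
    simp only [Fits, hpc] at hp
    have hlin' := hlin.inv (b := .inv .write (some n) p k) trivial hp (fun hm => hk (hfresh p k hm))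
    refine ⟨[], _, ⟨by rw [List.append_nil]; exact hlin', fun p' => ?_, fun p' k' hm => ?_⟩, rfl,
      fun s'' hs => hs⟩
    · have := hfits p'
      rw [pick_cons_of_label_inl rfl] at this
      by_cases hpp : p' = p
      · subst hpp; simp [Fits, Action.tid]
      · simp only [Action.tid, Function.update_of_ne hpp]
        exact this.congr (by simp [hpp]) (by simp [hpp]) rfl (by simp [hpp])
    · simp only [external_cons_inl, external_nil, List.filterMap_append, List.mem_append] at hm
      by_cases hpp : p' = p
      · subst hpp
        rcases hm with hm | hm
        · simp [hfresh _ _ hm]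
        · simp [Action.invKey?] at hm; simp [hm]
      · rcases hm with hm | hm
        · simp [hpp, hfresh _ _ hm]
        · simp [Action.invKey?, hpp] at hm
  | readRes p k hpc hk =>
    have hp := hfits p
    simp only [Fits, hpc, hk, Option.some.injEq, exists_eq_left'] at hp
    refine ⟨[], _, ⟨by rw [List.append_nil]; exact hlin.res hp, fun p' => ?_,
      fun p' k' hm => ?_⟩, rfl, fun s'' hs => hs⟩
    · have := hfits p'
      rw [pick_cons_of_label_inl rfl] at this
      by_cases hpp : p' = p
      · subst hpp; simp [Fits]
      · simp only [Function.update_of_ne hpp]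
        exact this.congr (by simp [hpp]) (by simp) (by simp [hpp]) (by simp [hpp])
    · simp only [external_cons_inl, external_nil, List.filterMap_append, List.mem_append] at hm
      simp only [List.filterMap_cons, Action.invKey?, List.filterMap_nil, List.not_mem_nil,
        or_false] at hm
      exact hfresh _ _ hm
  | writeRes p k hpc hk =>
    have hp := hfits p
    simp only [Fits, hpc, hk, Option.some.injEq, exists_eq_left'] at hp
    refine ⟨[], _, ⟨by rw [List.append_nil]; exact hlin.res hp, fun p' => ?_,
      fun p' k' hm => ?_⟩, rfl, fun s'' hs => hs⟩
    · have := hfits p'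
      rw [pick_cons_of_label_inl rfl] at this
      by_cases hpp : p' = p
      · subst hpp; simp [Fits]
      · simp only [Function.update_of_ne hpp]
        exact this.congr (by simp [hpp]) (by simp) (by simp [hpp]) (by simp [hpp])
    · simp only [external_cons_inl, external_nil, List.filterMap_append, List.mem_append] at hm
      simp only [List.filterMap_cons, Action.invKey?, List.filterMap_nil, List.not_mem_nil,
        or_false] at hm
      exact hfresh _ _ hm
  | writeInt p hpc =>
    have hp := hfits p
    simp only [Fits, hpc] at hp
    obtain ⟨k, hk, hp⟩ := hp
    refine ⟨_, _, ⟨by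
        rw [external_cons_inr, external_nil, List.append_nil]
        exact hlin.lin (r := .res .write none p k) hp trivial rfl rfl,
      fun p' => ?_, by simpa using hfresh⟩, ?_, fun s'' hs => by exact ⟨rfl, hs⟩⟩
    · have := hfits p'
      by_cases hpp : p' = p
      · subst hpp; simp [Fits, hk]
      · simp only [Function.update_of_ne hpp]
        rw [pick_cons_of_label_ne rfl hpp] at this
        exact this.congr (by simp [hpp]) rfl rfl rfl
    · simp [effect, hpc, writeOp, hk, restrictMethod, Action.method]
  | readInit p hpc =>
    have hp := hfits p
    simp only [Fits, hpc] at hp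
    obtain ⟨k, hk, hp⟩ := hp
    have hothers : ∀ p' f, p' ≠ p → Fits q p' (pick p' ts) (φ p') →
        Fits { q with
          pc := Function.update q.pc p .rLoop
          vs := Function.update q.vs p {q.val} } p' (pick p' ts) (Function.update φ p f p') := by
      intro p' f hpp this
      simp only [Function.update_of_ne hpp]
      exact this.congr (by simp [hpp]) rfl (by simp [hpp]) rfl
    -- The read is linearized now exactly if the value just loaded is the one it will pick.
    by_cases hx : pick p ts = some q.val
    · refine ⟨_, _, ⟨by
        rw [external_cons_inr, external_nil, List.append_nil]
        exact hlin.lin (r := .res .read (some q.val) p k) hp trivial rfl rfl,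
        fun p' => ?_, by simpa using hfresh⟩, ?_, fun s'' hs => by exact ⟨rfl, hs⟩⟩
      · have := hfits p'
        by_cases hpp : p' = p
        · subst hpp; simp [Fits, hk, hx]
        · rw [pick_cons_of_label_ne rfl hpp] at this
          exact hothers p' _ hpp this
      · simp [effect, hpc, restrictMethod, Action.method]
    · refine ⟨[], φ, ⟨by simpa using hlin, fun p' => ?_, by simpa using hfresh⟩, ?_,
        fun s'' hs => hs⟩
      · have := hfits p'
        by_cases hpp : p' = p
        · subst hpp; simp [Fits, hk, hp, hx]
        · rw [pick_cons_of_label_ne rfl hpp] at this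
          have := hothers p' .idle hpp this
          rwa [Function.update_of_ne hpp] at this
      · simp [effect, hpc, restrictMethod]
  | readLoop p hpc hval =>
    have hp := hfits p
    -- A loop step has the same label as the pick, but leaves the thread at `rLoop`, so the
    -- look-ahead passes over it.
    have hpick : pick p ((⟨q, _, _, hv⟩ : (WSR Tid Id).Transition) :: ts) = pick p ts := by
      simp [pick, hpc]
    simp only [Fits, hpc, hpick] at hp
    obtain ⟨k, hk, hp⟩ := hp
    have hothers : ∀ p' f, p' ≠ p → Fits q p' (pick p' ts) (φ p') →
        Fits { q with
          vs := Function.update q.vs p (q.vs p ∪ {q.val}) } p' (pick p' ts)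
            (Function.update φ p f p') := by
      intro p' f hpp this
      simp only [Function.update_of_ne hpp]
      exact this.congr rfl rfl (by simp [hpp]) rfl
    have hskip : Fits { q with vs := Function.update q.vs p (q.vs p ∪ {q.val}) } p
        (pick p ts) (φ p) →
        ∃ s' φ', Consistent { q with vs := Function.update q.vs p (q.vs p ∪ {q.val}) } ts
          (h ++ external [Sum.inr p]) (s ++ s') φ' ∧
          restrictMethod s' .write = effect (⟨q, _, _, hv⟩ : (WSR Tid Id).Transition) ∧
          ∀ s'', RegLegal q.val s'' → RegLegal q.val (s' ++ s'') := by
      intro hpf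
      refine ⟨[], φ, ⟨by simpa using hlin, fun p' => ?_, by simpa using hfresh⟩, ?_,
        fun s'' hs => hs⟩
      · have := hfits p'
        by_cases hpp : p' = p
        · subst hpp; exact hpf
        · rw [pick_cons_of_label_ne rfl hpp] at this
          have := hothers p' .idle hpp this
          rwa [Function.update_of_ne hpp] at this
      · simp [effect, hpc, restrictMethod]
    rcases hp with ⟨hp, hn⟩ | ⟨n, hn, hp⟩
    · by_cases hx : pick p ts = some q.val
      · refine ⟨_, _, ⟨by
          rw [external_cons_inr, external_nil, List.append_nil]
          exact hlin.lin (r := .res .read (some q.val) p k) hp trivial rfl rfl,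
          fun p' => ?_, by simpa using hfresh⟩, ?_, fun s'' hs => by exact ⟨rfl, hs⟩⟩
        · have := hfits p'
          by_cases hpp : p' = p
          · subst hpp; simp [Fits, hpc, hk, hx]
          · rw [pick_cons_of_label_ne rfl hpp] at this
            exact hothers p' _ hpp this
        · simp [effect, hpc, restrictMethod, Action.method]
      · apply hskip
        simp only [Fits, hpc, hk]
        refine ⟨k, rfl, Or.inl ⟨hp, ?_⟩⟩
        intro n hnm
        simp only [Function.update_self, Set.union_singleton, Set.mem_insert_iff] at hnm
        rcases hnm with rfl | hnm
        · exact hx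
        · exact hn n hnm
    · apply hskip
      simp only [Fits, hpc, hk]
      exact ⟨k, rfl, Or.inr ⟨n, hn, hp⟩⟩
  | readPick p out hpc hout =>
    have hp := hfits p
    have hpick : pick p ((⟨q, _, _, hv⟩ : (WSR Tid Id).Transition) :: ts) = some out := by
      simp [pick]
    simp only [Fits, hpc, hpick] at hp
    obtain ⟨k, hk, hp⟩ := hp
    rcases hp with ⟨-, hp⟩ | ⟨n, hn, hp⟩
    -- A read that is still pending has not loaded the value it is going to pick, but only loaded
    -- values can be picked.
    · exact absurd rfl (hp out hout)
    · obtain rfl := Option.some.inj hn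
      refine ⟨[], φ, ⟨by simpa using hlin, fun p' => ?_, by simpa using hfresh⟩, ?_,
        fun s'' hs => hs⟩
      · have := hfits p'
        by_cases hpp : p' = p
        · subst hpp; simp [Fits, hk, hp]
        · rw [pick_cons_of_label_ne rfl hpp] at this
          exact this.congr (by simp [hpp]) rfl rfl (by simp [hpp])
      · simp [effect, hpc, restrictMethod]

/-- `RegLegal` consumes a history from the front, so legality is assembled backwards: the operations
of each transition are put before a continuation that is legal from the next register value. -/
theorem Consistent.path {ts : List (WSR Tid Id).Transition} {q : State Tid Id}
    {h s : RegHistory Tid Id} {φ : Tid → Phase RegMethod ℕ Tid Id}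
    (H : Consistent q ts h s φ) (hts : (WSR Tid Id).IsPath q ts) :
    ∃ s' φ', Linearizing (h ++ external (ts.map LTS.Transition.label)) (s ++ s') φ' ∧
      restrictMethod s' .write = ts.flatMap effect ∧ RegLegal q.val s' := by
  induction ts generalizing q h s φ with
  | nil => exact ⟨[], φ, by simpa using H.lin, rfl, by simp [RegLegal]⟩
  | cons t ts ih =>
    obtain ⟨rfl, hts⟩ := hts
    obtain ⟨s₁, φ₁, h₁, hw₁, hl₁⟩ := H.step
    obtain ⟨s₂, φ₂, h₂, hw₂, hl₂⟩ := ih h₁ hts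
    refine ⟨s₁ ++ s₂, φ₂, ?_, ?_, hl₁ _ hl₂⟩
    · have : external ((t :: ts).map LTS.Transition.label)
          = external [t.label] ++ external (ts.map LTS.Transition.label) := by
        rw [← external_append]; rfl
      rw [this, ← List.append_assoc, ← List.append_assoc]
      exact h₂
    · rw [List.flatMap_cons, ← hw₁, ← hw₂]
      simp [restrictMethod]

theorem exists_linearization (e : (WSR Tid Id).Exec) :
    ∃ s φ, Linearizing e.hist s φ ∧ restrictMethod s .write = e.1.flatMap effect ∧
      RegLegal 0 s := by
  have H : Consistent (WSR Tid Id).init e.1 [] [] (fun _ => .idle) :=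
    ⟨Linearizing.nil, fun p => rfl, by simp⟩
  obtain ⟨s, φ, h⟩ := H.path e.2
  exact ⟨s, φ, h⟩

theorem validArgument (e : (WSR Tid Id).Exec) : ∀ a ∈ e.hist, ValidArgument a := by
  intro a ha
  simp only [LTS.Exec.hist, external, LTS.Exec.trace, List.mem_filterMap, List.mem_map] at ha
  obtain ⟨l, ⟨⟨q, l', q', hv⟩, -, rfl⟩, hl⟩ := ha
  have hv' : Step q l' q' := hv
  cases hv' <;> simp at hl <;> subst hl <;> simp [ValidArgument]

/-- The linearizations of different executions are chosen independently. Their writes still agree on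
prefixes, being computed by `effect` transition by transition without look-ahead. -/
theorem writeStronglyLinearizable : WriteStronglyLinearizable (WSR Tid Id) := by
  refine ⟨fun e => ⟨?_, validArgument e⟩, ?_⟩
  · obtain ⟨s, φ, H, -⟩ := exists_linearization e
    exact H.wellFormed
  · choose L φ hL hw hl using exists_linearization (Tid := Tid) (Id := Id)
    refine ⟨L, fun e => ⟨⟨(hL e).sequential, hl e⟩, (hL e).isLinearization⟩, fun e₁ e₂ he => ?_⟩
    obtain ⟨ts, hts⟩ := he
    rw [hw, hw, ← hts, List.flatMap_append]
    exact List.prefix_append _ _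

end WSR

/-! ### Forward simulation implies strong observational refinement -/

theorem exists_fork_of_not_prefix {α : Type*} : ∀ l₁ l₂ : List α,
    l₁ <+: l₂ ∨ l₂ <+: l₁ ∨ ∃ c a b, a ≠ b ∧ c ++ [a] <+: l₁ ∧ c ++ [b] <+: l₂
  | [], _ => Or.inl List.nil_prefix
  | _ :: _, [] => Or.inr (Or.inl List.nil_prefix)
  | x :: l₁, y :: l₂ => by
    by_cases hxy : x = y
    · subst hxy
      simp only [List.prefix_cons_inj]
      rcases exists_fork_of_not_prefix l₁ l₂ with h | h | ⟨c, a, b, hab, h₁, h₂⟩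
      · exact Or.inl h
      · exact Or.inr (Or.inl h)
      · exact Or.inr (Or.inr ⟨x :: c, a, b, hab, by simpa using h₁, by simpa using h₂⟩)
    · exact Or.inr (Or.inr ⟨[], x, y, hxy, by simp, by simp⟩)

theorem eq_of_concat_prefix {α : Type*} {l m : List α} {a b : α} (ha : l ++ [a] <+: m)
    (hb : l ++ [b] <+: m) : a = b := by
  have h := (List.prefix_of_prefix_length_le ha hb (by simp)).eq_of_length (by simp)
  simpa using h

/-- If two sequences extend `f` by distinct elements and also `c` by distinct elements, then
`f = c`. -/
theorem fork_unique {α : Type*} {f c m₁ m₂ : List α} {t₁ t₂ a b : α} (ht : t₁ ≠ t₂) (hab : a ≠ b)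
    (h₁ : f ++ [t₁] <+: m₁) (h₂ : f ++ [t₂] <+: m₂) (ha : c ++ [a] <+: m₁)
    (hb : c ++ [b] <+: m₂) : t₁ = a := by
  have hc₁ : c <+: m₁ := (List.prefix_append c [a]).trans ha
  have hc₂ : c <+: m₂ := (List.prefix_append c [b]).trans hb
  have hf₁ : f <+: m₁ := (List.prefix_append f [t₁]).trans h₁
  have hf₂ : f <+: m₂ := (List.prefix_append f [t₂]).trans h₂
  rcases lt_trichotomy f.length c.length with hl | hl | hl
  · exact absurd (eq_of_concat_prefix
      (List.prefix_of_prefix_length_le h₁ hc₁ (by simpa using hl))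
      (List.prefix_of_prefix_length_le h₂ hc₂ (by simpa using hl))) ht
  · have h := (List.prefix_of_prefix_length_le h₁ ha (by simp [hl])).eq_of_length (by simp [hl])
    exact (List.append_inj h hl).2 |> List.singleton_inj.1
  · exact absurd (eq_of_concat_prefix
      (List.prefix_of_prefix_length_le ha hf₁ (by simpa using hl))
      (List.prefix_of_prefix_length_le hb hf₂ (by simpa using hl))) hab

section Refinement

variable {Act Q ι Q' ι' QP π : Type*}

/-- The trace of the program in a sequence of transitions of a linked system. -/
def progTrace {A : LTS (QP × Q) (LinkLabel Act ι π)} (ts : List A.Transition) : List (Act ⊕ π) :=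
  (ts.map LTS.Transition.label).filterMap LinkLabel.toProg?

@[simp]
theorem progTrace_append {A : LTS (QP × Q) (LinkLabel Act ι π)} (ts ts' : List A.Transition) :
    progTrace (ts ++ ts') = progTrace ts ++ progTrace ts' := by
  simp [progTrace]

/-- Steps of `J` that the program can follow are steps of `P[J]`. -/
theorem exists_link_path {P : LTS QP (Act ⊕ π)} {J : LTS Q' (Act ⊕ ι')} {q q₁ : Q'}
    {ρ : List (Act ⊕ ι')} (h : J.Steps q ρ q₁) {p p₁ : QP}
    (hp : P.Steps p ((external ρ).map Sum.inl) p₁) :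
    ∃ ts : List (link P J).Transition, (link P J).IsPath (p, q) ts ∧
      LTS.target (p, q) ts = (p₁, q₁) ∧ progTrace ts = (external ρ).map Sum.inl := by
  induction h generalizing p with
  | nil q =>
    cases hp
    exact ⟨[], trivial, rfl, rfl⟩
  | @cons q q' q'' l ρ hl _ ih =>
    cases l with
    | inl a =>
      simp only [external_cons_inl, List.map_cons] at hp ⊢
      cases hp with
      | @cons _ p' _ _ _ hpl hps =>
        obtain ⟨ts, hts, htar, htr⟩ := ih hps
        exact ⟨⟨(p, q), .ext a, (p', q'), ⟨hpl, hl⟩⟩ :: ts, ⟨rfl, hts⟩,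
          by rw [LTS.target_cons]; exact htar, by rw [← htr]; rfl⟩
    | inr i =>
      obtain ⟨ts, hts, htar, htr⟩ := ih hp
      exact ⟨⟨(p, q), .impl i, (p, q'), ⟨rfl, hl⟩⟩ :: ts, ⟨rfl, hts⟩,
        by rw [LTS.target_cons]; exact htar, by rw [external_cons_inr, ← htr]; rfl⟩

/-- `ts` is a response of `P[J]` in state `b` to the transition `t` of `P[I]`. -/
structure Matches {P : LTS QP (Act ⊕ π)} {I : LTS Q (Act ⊕ ι)} {J : LTS Q' (Act ⊕ ι')}
    (R : Q → Q' → Prop) (b : QP × Q') (t : (link P I).Transition)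
    (ts : List (link P J).Transition) : Prop where
  path : (link P J).IsPath b ts
  fst : (LTS.target b ts).1 = t.post.1
  rel : R t.post.2 (LTS.target b ts).2
  trace : progTrace ts = progTrace [t]
  internal : ∀ j, t.label = .prog j → t.post.2 = t.pre.2 ∧
    ∃ t', ts = [t'] ∧ t'.label = .prog j ∧ t'.post.1 = t.post.1

/-- The premises stand inside the existential so that choice yields a total function of `b` and `t`
alone; where they fail, the empty list is a dummy value. -/
theorem exists_matches {P : LTS QP (Act ⊕ π)} {I : LTS Q (Act ⊕ ι)} {J : LTS Q' (Act ⊕ ι')}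
    {R : Q → Q' → Prop}
    (hR : ∀ (q q₁ : Q) (l : Act ⊕ ι) (q' : Q'), I.tr q l q₁ → R q q' →
      ∃ (q₁' : Q') (ρ : List (Act ⊕ ι')),
        J.Steps q' ρ q₁' ∧ external ρ = external [l] ∧ R q₁ q₁')
    (b : QP × Q') (t : (link P I).Transition) :
    ∃ ts, b.1 = t.pre.1 → R t.pre.2 b.2 → Matches (J := J) R b t ts := by
  by_cases hb : b.1 = t.pre.1 ∧ R t.pre.2 b.2
  swap
  · exact ⟨[], fun h h' => absurd ⟨h, h'⟩ hb⟩
  obtain ⟨hb, hr⟩ := hb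
  obtain ⟨⟨p, q⟩, l, ⟨p₁, q₁⟩, hv⟩ := t
  obtain ⟨p', q'⟩ := b
  obtain rfl : p' = p := hb
  cases l with
  | ext a =>
    obtain ⟨hvp, hvi⟩ := hv
    obtain ⟨q₁', ρ, hs, he, hr'⟩ := hR q q₁ _ q' hvi hr
    obtain ⟨ts, hts, htar, htr⟩ := exists_link_path (P := P) (p := p') (p₁ := p₁) hs
      (by rw [he]; exact .cons hvp (.nil _))
    exact ⟨ts, fun _ _ => ⟨hts, by rw [htar], by rw [htar]; exact hr', by rw [htr, he]; rfl,
      fun j hj => by cases hj⟩⟩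
  | impl i =>
    obtain ⟨hvp, hvi⟩ := hv
    obtain rfl : p₁ = p' := hvp
    obtain ⟨q₁', ρ, hs, he, hr'⟩ := hR q q₁ _ q' hvi hr
    obtain ⟨ts, hts, htar, htr⟩ := exists_link_path (P := P) (p := p₁) (p₁ := p₁) hs
      (by rw [he]; exact .nil _)
    exact ⟨ts, fun _ _ => ⟨hts, by rw [htar], by rw [htar]; exact hr', by rw [htr, he]; rfl,
      fun j hj => by cases hj⟩⟩
  | prog j =>
    obtain ⟨hvp, hvi⟩ := hv
    obtain rfl : q₁ = q := hvi
    refine ⟨[⟨(p', q'), .prog j, (p₁, q'), ⟨hvp, rfl⟩⟩], fun _ _ => ⟨⟨rfl, trivial⟩, rfl, hr, rfl,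
      fun j' hj => ⟨rfl, _, rfl, ?_, rfl⟩⟩⟩
    cases hj; rfl

/-- Forward simulation implies strong observational refinement. -/
theorem ForwardSimulated.stronglyRefines {Act : Type w} {Q : Type u} {ι : Type v} {Q' : Type u'}
    {ι' : Type v'} {I : LTS Q (Act ⊕ ι)} {J : LTS Q' (Act ⊕ ι')} (h : ForwardSimulated I J) :
    StronglyRefines.{u, v, w, u', v', x, y} I J := by
  obtain ⟨R, hinit, hR⟩ := h
  intro QP π P S hS
  choose ext hext using exists_matches (P := P) (J := J) hR
  let init : QP × Q' := (link P J).init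
  -- `F` concatenates the chosen matching runs. Each depends only on the state reached and the next
  -- transition, so prefixes are mapped to prefixes.
  let F : List (link P I).Transition → List (link P J).Transition :=
    List.foldl (fun f t => f ++ ext (LTS.target init f) t) []
  have F_concat : ∀ e t, F (e ++ [t]) = F e ++ ext (LTS.target init (F e)) t := fun e t => by
    simp [F]
  have F_mono : ∀ e e', e <+: e' → F e <+: F e' := by
    rintro e _ ⟨ts, rfl⟩
    induction ts using List.reverseRecOn with
    | nil => simp
    | append_singleton ts t ih =>
      rw [← List.append_assoc, F_concat]
      exact ih.trans (List.prefix_append _ _)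
  have F_spec : ∀ e, (link P I).IsPath (link P I).init e →
      (link P J).IsPath init (F e) ∧
      (LTS.target init (F e)).1 = (LTS.target (link P I).init e).1 ∧
      R (LTS.target (link P I).init e).2 (LTS.target init (F e)).2 ∧
      progTrace (F e) = progTrace e := by
    intro e
    induction e using List.reverseRecOn with
    | nil => exact fun _ => ⟨trivial, rfl, hinit, rfl⟩
    | append_singleton e t ih =>
      intro he
      rw [LTS.isPath_concat] at he
      obtain ⟨h₁, h₂, h₃, h₄⟩ := ih he.1
      rw [← he.2] at h₂ h₃
      have H := hext _ t h₂ h₃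
      rw [F_concat, LTS.isPath_append, LTS.target_append, LTS.target_concat, progTrace_append,
        progTrace_append, h₄, H.trace]
      exact ⟨⟨h₁, H.path⟩, H.fst, H.rel, rfl⟩
  have hmatch : ∀ e t, (link P I).IsPath (link P I).init (e ++ [t]) →
      Matches R (LTS.target init (F e)) t (ext (LTS.target init (F e)) t) := by
    intro e t he
    rw [LTS.isPath_concat] at he
    obtain ⟨-, h₂, h₃, -⟩ := F_spec e he.1
    rw [← he.2] at h₂ h₃
    exact hext _ t h₂ h₃
  have path_of_prefix : ∀ e e' : List (link P I).Transition, e <+: e' →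
      (link P I).IsPath (link P I).init e' → (link P I).IsPath (link P I).init e := by
    rintro e _ ⟨ts, rfl⟩ he
    exact ((LTS.isPath_append _ _ _).1 he).1
  -- Allowed are the transitions that continue `f` along the image of some execution consistent with
  -- `S`.
  let S' : Scheduler (link P J) := fun f =>
    {t | ∃ e : (link P I).Exec, S.Consistent e ∧ f.1 ++ [t] <+: F e.1}
  -- A fork between two images comes from a fork of the executions at `c`. Since `S` allows both
  -- branches there, they are program-internal, and their single matching transitions already
  -- separate the images; this is the only place where the images fork.
  have key : ∀ (e₁ e₂ : (link P I).Exec) (f : List (link P J).Transition) t₁ t₂,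
      S.Consistent e₁ → S.Consistent e₂ → f ++ [t₁] <+: F e₁.1 → f ++ [t₂] <+: F e₂.1 →
      t₁ ≠ t₂ → t₁.label.IsProgInternal := by
    intro e₁ e₂ f t₁ t₂ hc₁ hc₂ h₁ h₂ ht
    rcases exists_fork_of_not_prefix e₁.1 e₂.1 with h | h | ⟨c, a, b, hab, ha, hb⟩
    · exact absurd (eq_of_concat_prefix (h₁.trans (F_mono _ _ h)) h₂) ht
    · exact absurd (eq_of_concat_prefix h₁ (h₂.trans (F_mono _ _ h))) ht
    · have hpa := path_of_prefix _ _ ha e₁.2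
      have hpb := path_of_prefix _ _ hb e₂.2
      have hpc := path_of_prefix _ _ (List.prefix_append c [a]) hpa
      have haS := hc₁ ⟨c, hpc⟩ a ha
      have hbS := hc₂ ⟨c, hpc⟩ b hb
      rcases hS ⟨c, hpc⟩ with hsub | hint
      · exact absurd (hsub haS hbS) hab
      have prog_of : ∀ l : LinkLabel Act ι π, l.IsProgInternal → ∃ j, l = .prog j := by
        intro l hl
        cases l with
        | prog j => exact ⟨j, rfl⟩
        | _ => exact hl.elim
      obtain ⟨ja, hja⟩ := prog_of _ (hint a haS)
      obtain ⟨jb, hjb⟩ := prog_of _ (hint b hbS)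
      obtain ⟨hqa, a', ha', hla', hpa'⟩ := (hmatch c a hpa).internal ja hja
      obtain ⟨hqb, b', hb', hlb', hpb'⟩ := (hmatch c b hpb).internal jb hjb
      -- Program-internal transitions keep the implementation state, so with a common source they
      -- are determined by label and program target, and their matches share both with them.
      have hab' : a' ≠ b' := by
        rintro rfl
        apply hab
        have hpre : a.pre = b.pre := by
          rw [((LTS.isPath_concat _ _ _).1 hpa).2, ((LTS.isPath_concat _ _ _).1 hpb).2]
        apply LTS.Transition.ext hpre
        · rw [hja, hjb]
          rw [hla'] at hlb'
          cases hlb'; rfl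
        · exact Prod.ext (by rw [← hpa', hpb']) (by rw [hqa, hqb, hpre])
      have ha₁ := F_mono _ _ ha
      have hb₂ := F_mono _ _ hb
      rw [F_concat, ha'] at ha₁
      rw [F_concat, hb'] at hb₂
      rw [fork_unique ht hab' h₁ h₂ ha₁ hb₂, hla']
      trivial
  refine ⟨S', fun f => ?_, ?_⟩
  · by_cases hsub : (S' f).Subsingleton
    · exact Or.inl hsub
    · right
      intro t ht
      obtain ⟨t', ht', hne⟩ : ∃ t' ∈ S' f, t ≠ t' := by
        by_contra! hcon
        exact hsub fun x hx y hy => (hcon x hx).symm.trans (hcon y hy)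
      obtain ⟨e₁, hc₁, h₁⟩ := ht
      obtain ⟨e₂, hc₂, h₂⟩ := ht'
      exact key e₁ e₂ f.1 t t' hc₁ hc₂ h₁ h₂ hne
  -- `S'` may also stop inside a matching run. The run carries at most one program label, so the
  -- part executed shows either none of the trace of the transition or all of it.
  · have prefix_trace : ∀ (e : List (link P I).Transition) (f : List (link P J).Transition),
        (link P I).IsPath (link P I).init e → f <+: F e →
        ∃ e', e' <+: e ∧ progTrace e' = progTrace f := by
      intro e
      induction e using List.reverseRecOn with
      | nil =>
        intro f _ hf
        obtain rfl := List.prefix_nil.1 hf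
        exact ⟨[], List.prefix_rfl, rfl⟩
      | append_singleton e t ih =>
        intro f he hf
        have hM := hmatch e t he
        rw [F_concat] at hf
        have he' := path_of_prefix _ _ (List.prefix_append e [t]) he
        rcases List.prefix_or_prefix_of_prefix hf (List.prefix_append (F e) _) with h | ⟨x, rfl⟩
        · obtain ⟨e', h₁, h₂⟩ := ih f he' h
          exact ⟨e', h₁.trans (List.prefix_append _ _), h₂⟩
        · rw [List.prefix_append_right_inj] at hf
          obtain ⟨z, hz⟩ := hf
          have htr := hM.trace
          rw [← hz, progTrace_append] at htr
          have hF := (F_spec e he').2.2.2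
          have hlen : (progTrace [t]).length ≤ 1 := by
            simp only [progTrace, List.map_cons, List.map_nil]
            exact List.length_filterMap_le _ _
          cases hx : progTrace x with
          | nil => exact ⟨e, List.prefix_append _ _, by rw [progTrace_append, hF, hx]; simp⟩
          | cons c l =>
            refine ⟨e ++ [t], List.prefix_rfl, ?_⟩
            rw [progTrace_append, progTrace_append, hF, ← htr, hx]
            rw [← htr, hx] at hlen
            simp only [List.length_append, List.length_cons] at hlen
            rw [List.length_eq_zero_iff.1 (show (progTrace z).length = 0 by omega), List.append_nil]
    ext ρ
    constructor
    · rintro ⟨e, hc, rfl⟩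
      obtain ⟨h₁, -, -, h₄⟩ := F_spec e.1 e.2
      exact ⟨⟨F e.1, h₁⟩, fun e₁ t ht => ⟨e, hc, ht⟩, h₄.symm⟩
    · rintro ⟨f, hc, rfl⟩
      -- The last transition of `f` is allowed by `S'`, and its witness `e` already has all of `f`
      -- as a prefix of its image.
      obtain ⟨e, hce, hfe⟩ : ∃ e : (link P I).Exec, S.Consistent e ∧ f.1 <+: F e.1 := by
        rcases List.eq_nil_or_concat f.1 with hf | ⟨f₀, t, hf⟩
        · refine ⟨⟨[], trivial⟩, fun e₁ t ht => ?_, by rw [hf]; exact List.nil_prefix⟩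
          exact absurd ht.length_le (by simp)
        · rw [List.concat_eq_append] at hf
          have hf₀ : (link P J).IsPath (link P J).init f₀ := by
            have := f.2
            rw [hf, LTS.isPath_concat] at this
            exact this.1
          obtain ⟨e, hce, he⟩ := hc ⟨f₀, hf₀⟩ t (by rw [hf])
          exact ⟨e, hce, by rw [hf]; exact he⟩
      obtain ⟨e', he', htr⟩ := prefix_trace e.1 f.1 e.2 hfe
      exact ⟨⟨e', path_of_prefix _ _ he' e.2⟩, fun e₁ t ht => hce e₁ t (ht.trans he'), htr.symm⟩

end Refinement

/-! ### Writes and values in legal register histories -/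

open History

theorem History.restrictTid_singleton_inv {M V Tid Id : Type*} {m : M} {v : Option V} {p : Tid}
    {k : Id} : restrictTid [Action.inv m v p k] p = [Action.inv m v p k] :=
  restrictTid_singleton_self _

section RegisterHistories

variable {Tid : Type*} {Id : Type*}

def IsWriteInv : RegAction Tid Id → Prop
  | .inv .write _ _ _ => True
  | _ => False

/-- The value that a write invocation carries. -/
def written : RegAction Tid Id → ℕ
  | .inv .write (some n) _ _ => n
  | _ => 0

/-- The value of a register that holds `x` after the writes in `W`. -/
def valueAfter (x : ℕ) (W : RegHistory Tid Id) : ℕ := W.getLast?.elim x written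

open Classical in
/-- The invocations of writes in a history. -/
noncomputable def writeInvs (s : RegHistory Tid Id) : RegHistory Tid Id :=
  s.filter fun a => IsWriteInv a

theorem IsWriteInv.isInv {a : RegAction Tid Id} (h : IsWriteInv a) : a.IsInv := by
  cases a with
  | inv => trivial
  | res => exact h.elim

theorem mem_writeInvs {s : RegHistory Tid Id} {a : RegAction Tid Id} :
    a ∈ writeInvs s ↔ a ∈ s ∧ IsWriteInv a := by
  simp [writeInvs]

theorem writeInvs_append (s s' : RegHistory Tid Id) :
    writeInvs (s ++ s') = writeInvs s ++ writeInvs s' := by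
  simp [writeInvs]

/-- Carries the prefix property of a write strong mapping over to the write invocations, which are
what is counted below. -/
theorem writeInvs_restrictMethod (s : RegHistory Tid Id) :
    writeInvs (restrictMethod s .write) = writeInvs s := by
  rw [writeInvs, restrictMethod, List.filter_filter, writeInvs]
  apply List.filter_congr
  intro a _
  rw [Bool.eq_iff_iff]
  simp only [Bool.and_eq_true, decide_eq_true_eq, and_iff_left_iff_imp]
  rcases a with ⟨_ | _, v, p, k⟩ | _ <;> simp [IsWriteInv, Action.method]

theorem writeInvs_cons_of_pos {a : RegAction Tid Id} (ha : IsWriteInv a) (s : RegHistory Tid Id) :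
    writeInvs (a :: s) = a :: writeInvs s := by
  simp [writeInvs, ha]

theorem writeInvs_cons_of_neg {a : RegAction Tid Id} (ha : ¬ IsWriteInv a)
    (s : RegHistory Tid Id) : writeInvs (a :: s) = writeInvs s := by
  simp [writeInvs, ha]

theorem nodup_writeInvs {s : RegHistory Tid Id} (h : (s.filterMap Action.invKey?).Nodup) :
    (writeInvs s).Nodup := by
  induction s with
  | nil => simp [writeInvs]
  | cons a s ih =>
    by_cases ha : IsWriteInv a
    · rw [List.filterMap_cons_some (invKey?_of_isInv ha.isInv), List.nodup_cons] at h
      rw [writeInvs_cons_of_pos ha, List.nodup_cons]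
      exact ⟨fun hm => h.1 (mem_invKeys.2 ⟨a, (mem_writeInvs.1 hm).1, ha.isInv, rfl⟩), ih h.2⟩
    · rw [writeInvs_cons_of_neg ha]
      exact ih (List.Nodup.sublist ((List.sublist_cons_self _ _).filterMap _) h)

theorem valueAfter_cons (x : ℕ) (a : RegAction Tid Id) (W : RegHistory Tid Id) :
    valueAfter x (a :: W) = valueAfter (written a) W := by
  cases W with
  | nil => rfl
  | cons b W => simp [valueAfter, List.getLast?_cons]

/-- In a legal history, a read returns the value written last. -/
theorem RegLegal.read : ∀ {x : ℕ} {A B : RegHistory Tid Id} {i r : RegAction Tid Id},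
    RegLegal x (A ++ i :: r :: B) → i.IsInv → i.method = .read →
      ∃ p k, r = .res .read (some (valueAfter x (writeInvs A))) p k
  | x, [], B, i, r, h, hi, hm => by
    rcases i with ⟨_ | _, _ | _, p, k⟩ | _ <;> rcases r with _ | ⟨_ | _, v, p', k'⟩ <;>
      simp_all [RegLegal, Action.IsInv, Action.method, valueAfter, writeInvs]
  | x, [a], B, i, r, h, hi, hm => by
    rcases a with ⟨_ | _, _ | _, p, k⟩ | _ <;> rcases i with _ | ⟨_ | _, v, p', k'⟩ <;>
      simp_all [RegLegal, Action.IsInv, Action.method]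
  | x, a :: b :: A, B, i, r, h, hi, hm => by
    rcases a with ⟨_ | _, _ | n, p, k⟩ | _ <;> rcases b with _ | ⟨_ | _, v, p', k'⟩ <;>
      simp only [List.cons_append, RegLegal] at h
    · rw [writeInvs_cons_of_neg id, writeInvs_cons_of_neg id]
      exact RegLegal.read h.2 hi hm
    · rw [writeInvs_cons_of_pos (by trivial), writeInvs_cons_of_neg id, valueAfter_cons]
      exact RegLegal.read h.2 hi hm

theorem RegLegal.write : ∀ {x : ℕ} {s : RegHistory Tid Id} {v : Option ℕ} {p : Tid} {k : Id},
    RegLegal x s → .res .write v p k ∈ s → v = none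
  | _, [], _, _, _, _, hm => by simp at hm
  | x, [a], v, p, k, h, hm => by
    simp only [List.mem_singleton] at hm
    subst hm
    simp [RegLegal] at h
  | x, a :: b :: s, v, p, k, h, hm => by
    rcases a with ⟨_ | _, _ | n, p, k⟩ | _ <;> rcases b with _ | ⟨_ | _, v, p', k'⟩ <;>
      simp only [RegLegal] at h
    · simp only [List.mem_cons, reduceCtorEq, false_or, Action.res.injEq, false_and] at hm
      exact RegLegal.write h.2 hm
    · simp only [List.mem_cons, reduceCtorEq, false_or, Action.res.injEq, true_and] at hm
      rcases hm with hm | hm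
      · rw [hm.1, h.1]
      · exact RegLegal.write h.2 hm

end RegisterHistories

/-! ### Completed operations inside a linearization -/

namespace History

variable {M : Type*} {V : Type*} {Tid : Type*} {Id : Type*} {h s : History M V Tid Id}

theorem IsLinearization.mem_of_isInv (hl : IsLinearization h s) {a : Action M V Tid Id}
    (ha : a ∈ s) (hi : a.IsInv) : a ∈ h := by
  obtain ⟨-, rs, hrs, -, hr, -⟩ := hl
  have h1 : a ∈ restrictTid (completed (h ++ rs)) a.tid := by
    rw [← hr]; exact mem_restrictTid.2 ⟨ha, rfl⟩
  rcases List.mem_append.1 (mem_completed.1 (mem_restrictTid.1 h1).1).1 with h2 | h2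
  · exact h2
  · exact absurd (hrs a h2) (not_isRes_of_isInv hi)

theorem IsLinearization.mem (hl : IsLinearization h s) {i r a : Action M V Tid Id} (hih : i ∈ h)
    (hrh : r ∈ h) (hi : i.IsInv) (hr : r.IsRes) (hk : i.key = r.key) (hah : a ∈ h)
    (ha : a.key = r.key) : a ∈ s := by
  obtain ⟨-, rs, -, -, hrest, -⟩ := hl
  have h1 : a ∈ restrictTid s a.tid := by
    rw [hrest]
    refine mem_restrictTid.2 ⟨mem_completed.2 ⟨List.mem_append_left _ hah, ?_⟩, rfl⟩
    rw [ha]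
    exact ⟨⟨i, List.mem_append_left _ hih, hi, hk⟩, ⟨r, List.mem_append_left _ hrh, hr, rfl⟩⟩
  exact (mem_restrictTid.1 h1).1

theorem IsLinearization.eq_append (hl : IsLinearization h s) (hw : WellFormed h)
    {i r : Action M V Tid Id} (hih : i ∈ h) (hrh : r ∈ h) (hi : i.IsInv) (hr : r.IsRes)
    (hk : i.key = r.key) : ∃ A B, s = A ++ i :: r :: B := by
  obtain ⟨A, B, hAB⟩ := List.append_of_mem (hl.mem hih hrh hi hr hk hrh rfl)
  obtain ⟨A', j, rfl, hj, -, hjk⟩ := hl.1.1.exists_inv hAB hr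
  have hjh : j ∈ h := hl.mem_of_isInv (by rw [hAB]; simp) hj
  obtain rfl := inv_eq_of_key_eq hw.nodup hjh hih hj hi (hjk.trans hk.symm)
  exact ⟨A', B, by rw [hAB]; simp⟩

/-- A completed operation precedes in the linearization the operations invoked after it. -/
theorem IsLinearization.precedes (hl : IsLinearization h s) (hw : WellFormed h)
    {h₁ h₂ : History M V Tid Id} (hh : h = h₁ ++ h₂) {i r j : Action M V Tid Id} (hih : i ∈ h₁)
    (hrh : r ∈ h₁) (hi : i.IsInv) (hr : r.IsRes) (hk : i.key = r.key)
    {A B : History M V Tid Id} (hs : s = A ++ j :: B) (hj : j.IsInv)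
    (hjk : j.key ∉ h₁.filterMap Action.invKey?) : ∃ A₁ r' A₂, A = A₁ ++ i :: r' :: A₂ := by
  have hl' := hl
  obtain ⟨hseq, rs, hrs, -, hrest, hrt⟩ := hl'
  have hjh : j ∈ h := hl.mem_of_isInv (by rw [hs]; simp) hj
  have hjh₂ : j ∈ h₂ := by
    rw [hh] at hjh
    rcases List.mem_append.1 hjh with h1 | h1
    · exact absurd (mem_invKeys.2 ⟨j, h1, hj, rfl⟩) hjk
    · exact h1
  have hih' : i ∈ h := by rw [hh]; exact List.mem_append_left _ hih
  have hrh' : r ∈ h := by rw [hh]; exact List.mem_append_left _ hrh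
  have hsub : List.Sublist [r, j] (h ++ rs) := by
    rw [hh]
    exact (pair_sublist_of_mem hrh hjh₂).trans (List.sublist_append_left _ _)
  have hcr : CompletedOp (h ++ rs) r.key :=
    ⟨⟨i, List.mem_append_left _ hih', hi, hk⟩, ⟨r, List.mem_append_left _ hrh', hr, rfl⟩⟩
  have hcj : CompletedOp (h ++ rs) j.key := by
    have h1 : j ∈ restrictTid (completed (h ++ rs)) j.tid := by
      rw [← hrest]; exact mem_restrictTid.2 ⟨by rw [hs]; simp, rfl⟩
    exact (mem_completed.1 (mem_restrictTid.1 h1).1).2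
  have hsub' : List.Sublist [r, j] (completed (h ++ rs)) := by
    classical
    have := hsub.filter (fun a => decide (CompletedOp (h ++ rs) a.key))
    rw [List.filter_eq_self.2 (by simp [hcr, hcj])] at this
    rw [completed]
    convert this
  obtain ⟨r', j', hr', hrk', hj', hjk', hsub''⟩ :=
    hrt r.key j.key ⟨r, j, hr, rfl, hj, rfl, hsub'⟩
  obtain rfl : j' = j := inv_eq_of_key_eq hseq.2 (hsub''.subset (by simp)) (by rw [hs]; simp)
    hj' hj hjk'
  obtain ⟨R₁, R₂, hR, hr₁, hj₂⟩ := List.cons_sublist_iff.1 hsub''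
  obtain ⟨Y₁, Y₂, rfl⟩ := List.append_of_mem (List.singleton_sublist.1 hj₂)
  have hA : A = R₁ ++ Y₁ := by
    have h1 : A ++ j' :: B = (R₁ ++ Y₁) ++ j' :: Y₂ := by rw [← hs, hR]; simp
    exact (inv_split_unique (hs ▸ hseq.2) h1 hj hj rfl).1
  obtain ⟨A₀, B₀, hA₀⟩ := List.append_of_mem (show r' ∈ A by rw [hA]; simp [hr₁])
  have halt : Alternating A := Alternating.of_append_left (hs ▸ hseq.1)
  obtain ⟨A₁, a, rfl, ha, -, hak⟩ := halt.exists_inv hA₀ hr'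
  have hah : a ∈ h := hl.mem_of_isInv (by rw [hs, hA₀]; simp) ha
  obtain rfl := inv_eq_of_key_eq hw.nodup hah hih' ha hi (by rw [hak, hrk', hk])
  exact ⟨A₁, r', B₀, by rw [hA₀]; simp⟩

end History

/-! ### The simulation invariant and the moves of `WSR` -/

namespace WSR

variable {Tid : Type*} {Id : Type*}

/-- `s'` is reachable from `s` by internal steps. -/
def Silent (s s' : State Tid Id) : Prop :=
  ∃ ρ, (WSR Tid Id).Steps s ρ s' ∧ external ρ = []

theorem Silent.refl (s : State Tid Id) : Silent s s := ⟨[], .nil s, rfl⟩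

theorem Silent.trans {s s' s'' : State Tid Id} (h : Silent s s') (h' : Silent s' s'') :
    Silent s s'' := by
  obtain ⟨ρ, h, hρ⟩ := h
  obtain ⟨ρ', h', hρ'⟩ := h'
  exact ⟨ρ ++ ρ', h.trans h', by rw [external_append, hρ, hρ']; rfl⟩

theorem Silent.of_step {s s' : State Tid Id} {p : Tid} (h : Step s (Sum.inr p) s') :
    Silent s s' := ⟨[Sum.inr p], .cons h (.nil _), rfl⟩

/-- The reads of finitely many threads can collect the current value. -/
theorem exists_collect (l : List Tid) (s : State Tid Id) :
    ∃ vs', Silent s { s with vs := vs' } ∧ (∀ p, s.vs p ⊆ vs' p) ∧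
      ∀ p ∈ l, s.pc p = .rLoop → s.val ∈ vs' p := by
  classical
  induction l with
  | nil => exact ⟨s.vs, Silent.refl s, fun p => subset_rfl, by simp⟩
  | cons q l ih =>
    obtain ⟨vs', hs, hsub, hval⟩ := ih
    by_cases hq : s.pc q = .rLoop ∧ s.val ∉ vs' q
    · refine ⟨_, hs.trans (Silent.of_step (.readLoop _ q hq.1 hq.2)), fun p => ?_,
        fun p hp hpc => ?_⟩
      · by_cases hpq : p = q
        · subst hpq
          simp only [Function.update_self]
          exact (hsub p).trans Set.subset_union_left
        · simpa [hpq] using hsub p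
      · by_cases hpq : p = q
        · subst hpq; simp
        · simpa [hpq] using hval p (by simpa [hpq] using hp) hpc
    · refine ⟨vs', hs, hsub, fun p hp hpc => ?_⟩
      rcases List.mem_cons.1 hp with rfl | hp
      · by_contra hcon
        exact hq ⟨hpc, hcon⟩
      · exact hval p hp hpc

/-- The state of thread `p` fits the last action `a?` of `p`, where the first `m` writes of `W` have
been executed, and `m₀` of them before the pending read of `p` was invoked. -/
def ThreadSim (W : RegHistory Tid Id) (m m₀ : ℕ) (s : State Tid Id) (p : Tid) :
    Option (RegAction Tid Id) → Prop
  | none => s.pc p = .main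
  | some (.res _ _ _ _) => s.pc p = .main
  | some (.inv .write v q k) =>
      (.inv .write v q k ∈ W.take m ∧ s.pc p = .wEnd) ∨
      (.inv .write v q k ∉ W.take m ∧ s.pc p = .wBegin ∧ v = some (s.arg p))
  | some (.inv .read _ _ _) =>
      s.pc p = .rLoop ∧ m₀ ≤ m ∧ ∀ j, m₀ ≤ j → j ≤ m → valueAfter 0 (W.take j) ∈ s.vs p

/-- The state `s` has executed the history `h` and the first `m` writes of `W`. -/
structure Sim (h W : RegHistory Tid Id) (m : ℕ) (μ : Tid → ℕ) (s : State Tid Id) : Prop where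
  le : m ≤ W.length
  val : s.val = valueAfter 0 (W.take m)
  ids : ∀ p, s.ids p = ((restrictTid h p).filterMap Action.invKey?).map Prod.snd
  thread : ∀ p, ThreadSim W m (μ p) s p (restrictTid h p).getLast?
  done : ∀ a ∈ h, IsWriteInv a → a ∈ W.take m ∨ (restrictTid h a.tid).getLast? = some a

theorem ThreadSim.congr {W W' : RegHistory Tid Id} {m m₀ m₀' : ℕ} {s s' : State Tid Id} {p : Tid}
    {a? : Option (RegAction Tid Id)} (h : ThreadSim W m m₀ s p a?)
    (hW : ∀ j ≤ m, W'.take j = W.take j) (hm : m₀' = m₀) (hpc : s'.pc p = s.pc p)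
    (hvs : s'.vs p = s.vs p) (harg : s'.arg p = s.arg p) : ThreadSim W' m m₀' s' p a? := by
  subst hm
  match a? with
  | none => simpa [ThreadSim, hpc] using h
  | some (.res _ _ _ _) => simpa [ThreadSim, hpc] using h
  | some (.inv .write v q k) => simpa [ThreadSim, hpc, hW m le_rfl, harg] using h
  | some (.inv .read _ _ _) =>
    obtain ⟨h₁, h₂, h₃⟩ := h
    refine ⟨by rw [hpc, h₁], h₂, fun j hj hj' => ?_⟩
    rw [hW j hj', hvs]
    exact h₃ j hj hj'

/-- `Sim` looks at `W` only through its first `m` elements, so the writes may be extended by later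
linearizations. -/
theorem Sim.mono {h W W' : RegHistory Tid Id} {m : ℕ} {μ : Tid → ℕ} {s : State Tid Id}
    (H : Sim h W m μ s) (hW : W <+: W') : Sim h W' m μ s := by
  have htake : ∀ j ≤ m, W'.take j = W.take j := by
    obtain ⟨W₂, rfl⟩ := hW
    intro j hj
    exact List.take_append_of_le_length (hj.trans H.le)
  refine ⟨H.le.trans hW.length_le, by rw [htake m le_rfl, H.val], H.ids,
    fun p => (H.thread p).congr htake rfl rfl rfl rfl, ?_⟩
  rw [htake m le_rfl]
  exact H.done

/-- The next write of `W` has been invoked but not executed, so by `done` it is the pending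
operation of its thread and can take effect. Afterwards all looping reads load the new value, so
that none is missed. -/
theorem Sim.advance_one {h W : RegHistory Tid Id} {m : ℕ} {μ : Tid → ℕ} {s : State Tid Id}
    (H : Sim h W m μ s) (hm : m < W.length) (hW : W.Nodup) (hWh : ∀ a ∈ W, a ∈ h ∧ IsWriteInv a) :
    ∃ s', Silent s s' ∧ Sim h W (m + 1) μ s' := by
  classical
  obtain ⟨hah, haw⟩ := hWh W[m] (List.getElem_mem hm)
  have htake : W.take (m + 1) = W.take m ++ [W[m]] := (List.take_append_getElem hm).symm
  have hnot : W[m] ∉ W.take m := by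
    intro hmem
    have h1 : (W.take (m + 1)).Nodup := List.Nodup.sublist (List.take_sublist _ _) hW
    rw [htake, List.nodup_append] at h1
    exact h1.2.2 _ hmem _ (by simp) rfl
  have hlast := (H.done _ hah haw).resolve_left hnot
  obtain ⟨v, p, k, ha⟩ : ∃ v p k, W[m] = .inv .write v p k := by
    revert haw
    rcases W[m] with ⟨_ | _, v, p, k⟩ | _ <;> simp [IsWriteInv]
  have hth := H.thread p
  rw [ha] at hlast hnot
  simp only [Action.tid] at hlast
  rw [hlast] at hth
  obtain ⟨-, hpc, hv⟩ := hth.resolve_left fun h1 => hnot h1.1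
  -- A pending read has its invocation in `h`, so the finitely many threads of `h` are enough.
  obtain ⟨vs', hs, hsub, hval⟩ := exists_collect (h.map Action.tid)
    { s with val := s.arg p, pc := Function.update s.pc p .wEnd }
  dsimp only at hs hsub hval
  refine ⟨_, (Silent.of_step (.writeInt s p hpc)).trans hs, hm, ?_, H.ids, fun q => ?_, ?_⟩
  · simp [htake, valueAfter, ha, hv, written]
  · by_cases hq : q = p
    · subst hq
      rw [hlast]
      exact Or.inl ⟨by rw [htake, ha]; simp, by simp⟩
    · have hth := H.thread q
      cases e : (restrictTid h q).getLast? with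
      | none => rw [e] at hth; simpa [ThreadSim, hq] using hth
      | some a =>
        rw [e] at hth
        have haq : a ∈ restrictTid h q := List.mem_of_getLast? e
        rw [mem_restrictTid] at haq
        match a with
        | .res _ _ _ _ => simpa [ThreadSim, hq] using hth
        | .inv .write v' q' k' =>
          obtain rfl : q' = q := haq.2
          have hiff : Action.inv RegMethod.write v' q' k' ∈ W.take (m + 1) ↔
              Action.inv RegMethod.write v' q' k' ∈ W.take m := by
            rw [htake, ha]; simp [hq]
          simpa [ThreadSim, hq, hiff] using hth
        | .inv .read v' q' k' =>
          obtain ⟨h₁, h₂, h₃⟩ := hth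
          refine ⟨by simpa [hq] using h₁, by omega, fun j hj hj' => ?_⟩
          rcases Nat.lt_or_ge m j with hlt | hge
          · obtain rfl : j = m + 1 := by omega
            have := hval q (List.mem_map.2 ⟨_, haq⟩) (by simpa [hq] using h₁)
            simpa [htake, valueAfter, ha, hv, written] using this
          · exact hsub q (h₃ j hj hge)
  · intro b hb hbw
    rw [htake]
    rcases H.done b hb hbw with h1 | h1
    · exact Or.inl (List.mem_append_left _ h1)
    · exact Or.inr h1

theorem Sim.advance {h W : RegHistory Tid Id} {m j : ℕ} {μ : Tid → ℕ} {s : State Tid Id}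
    (H : Sim h W m μ s) (hmj : m ≤ j) (hj : j ≤ W.length) (hW : W.Nodup)
    (hWh : ∀ a ∈ W, a ∈ h ∧ IsWriteInv a) : ∃ s', Silent s s' ∧ Sim h W j μ s' := by
  induction j, hmj using Nat.le_induction with
  | base => exact ⟨s, Silent.refl s, H⟩
  | succ j hmj ih =>
    obtain ⟨s₁, hs₁, H₁⟩ := ih (by omega)
    obtain ⟨s₂, hs₂, H₂⟩ := H₁.advance_one (by omega) hW hWh
    exact ⟨s₂, hs₁.trans hs₂, H₂⟩

theorem Sim.getLast?_ids {h W : RegHistory Tid Id} {m : ℕ} {μ : Tid → ℕ} {s : State Tid Id}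
    (H : Sim h W m μ s) {p : Tid} {a : RegAction Tid Id} (ha : a.IsInv)
    (hl : (restrictTid h p).getLast? = some a) : (s.ids p).getLast? = some a.id := by
  obtain ⟨l, hl⟩ := List.getLast?_eq_some_iff.1 hl
  rw [H.ids, hl, List.filterMap_append, List.filterMap_cons_some (invKey?_of_isInv ha)]
  simp [Action.key]

theorem Sim.main_of_inv {h W : RegHistory Tid Id} {m : ℕ} {μ : Tid → ℕ} {s : State Tid Id}
    (H : Sim h W m μ s) {b : RegAction Tid Id} (hb : b.IsInv) (hw : WellFormed (h ++ [b])) :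
    s.pc b.tid = .main ∧ b.id ∉ s.ids b.tid ∧ b.key ∉ h.filterMap Action.invKey? ∧
      ∀ a, (restrictTid h b.tid).getLast? = some a → a.IsRes := by
  have h1 := (hw b.tid).1
  rw [restrictTid_append, restrictTid_singleton_self, alternating_concat] at h1
  have hlast : ∀ a, (restrictTid h b.tid).getLast? = some a → a.IsRes := by
    intro a ha
    have h2 := h1.2
    rw [ha] at h2
    rcases h2 with h2 | h2
    · exact h2.1
    · exact absurd h2.2.1 (not_isRes_of_isInv hb)
  have hkey : b.key ∉ h.filterMap Action.invKey? := by
    have h2 := hw.nodup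
    rw [List.filterMap_append, List.filterMap_cons_some (invKey?_of_isInv hb),
      List.nodup_append] at h2
    exact fun hm => h2.2.2 _ hm b.key (by simp) rfl
  refine ⟨?_, fun hm => hkey ?_, hkey, hlast⟩
  · have hth := H.thread b.tid
    cases e : (restrictTid h b.tid).getLast? with
    | none => rw [e] at hth; exact hth
    | some a =>
      rw [e] at hth
      have := hlast a e
      match a with
      | .res _ _ _ _ => exact hth
      | .inv _ _ _ _ => exact this.elim
  · rw [H.ids, List.mem_map] at hm
    obtain ⟨o, ho, hoid⟩ := hm
    obtain ⟨a, ha, hi, hk⟩ := mem_invKeys.1 ho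
    rw [mem_restrictTid] at ha
    refine mem_invKeys.2 ⟨a, ha.1, hi, Prod.ext ha.2 ?_⟩
    rw [hk, hoid]; rfl

open Classical in
-- The first load follows the invocation at once. It collects the value after `m` writes, whence the
-- new lower end `m` for thread `p`.
theorem Sim.readInv {h W : RegHistory Tid Id} {m : ℕ} {μ : Tid → ℕ} {s : State Tid Id}
    (H : Sim h W m μ s) {p : Tid} {k : Id} (hw : WellFormed (h ++ [.inv .read none p k])) :
    ∃ s' ρ, (WSR Tid Id).Steps s ρ s' ∧ external ρ = [.inv .read none p k] ∧
      Sim (h ++ [.inv .read none p k]) W m (Function.update μ p m) s' := by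
  obtain ⟨hpc, hid, -, hlast⟩ := H.main_of_inv (b := .inv .read none p k) trivial hw
  simp only [Action.tid, Action.id] at hpc hid hlast
  refine ⟨_, _, .cons (.readInv s p k hpc hid) (.cons (.readInit _ p (by simp)) (.nil _)), rfl,
    H.le, H.val, fun q => ?_, fun q => ?_, ?_⟩
  · by_cases hq : q = p
    · subst hq
      rw [restrictTid_append, restrictTid_singleton_inv]
      simp [H.ids, Action.invKey?]
    · rw [restrictTid_append, restrictTid_singleton_of_ne (by simpa [Action.tid] using Ne.symm hq)]
      simp [H.ids, hq]
  · by_cases hq : q = p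
    · subst hq
      rw [restrictTid_append, restrictTid_singleton_inv, List.getLast?_concat]
      refine ⟨by simp, by simp, fun j hj hj' => ?_⟩
      simp only [Function.update_self] at hj
      obtain rfl : j = m := by omega
      simp [H.val]
    · rw [restrictTid_append, restrictTid_singleton_of_ne (by simpa [Action.tid] using Ne.symm hq),
        List.append_nil]
      exact (H.thread q).congr (fun _ _ => rfl) (by simp [hq]) (by simp [hq]) (by simp [hq]) rfl
  · intro a ha haw
    rcases List.mem_append.1 ha with ha | ha
    · rcases H.done a ha haw with h1 | h1
      · exact Or.inl h1
      · by_cases hq : a.tid = p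
        · rw [hq] at h1
          exact absurd (hlast a h1) (not_isRes_of_isInv haw.isInv)
        · rw [restrictTid_append,
            restrictTid_singleton_of_ne (by simpa [Action.tid] using Ne.symm hq), List.append_nil]
          exact Or.inr h1
    · rw [List.mem_singleton] at ha
      subst ha
      exact haw.elim

theorem Sim.writeInv {h W : RegHistory Tid Id} {m : ℕ} {μ : Tid → ℕ} {s : State Tid Id}
    (H : Sim h W m μ s) {p : Tid} {k : Id} {n : ℕ}
    (hw : WellFormed (h ++ [.inv .write (some n) p k])) (hWh : ∀ a ∈ W.take m, a ∈ h) :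
    ∃ s' ρ, (WSR Tid Id).Steps s ρ s' ∧ external ρ = [.inv .write (some n) p k] ∧
      Sim (h ++ [.inv .write (some n) p k]) W m μ s' := by
  classical
  obtain ⟨hpc, hid, hkey, hlast⟩ := H.main_of_inv (b := .inv .write (some n) p k) trivial hw
  simp only [Action.tid, Action.id] at hpc hid hlast
  refine ⟨_, _, .cons (.writeInv s p k n hpc hid) (.nil _), rfl,
    H.le, H.val, fun q => ?_, fun q => ?_, ?_⟩
  · by_cases hq : q = p
    · subst hq
      rw [restrictTid_append, restrictTid_singleton_inv]
      simp [H.ids, Action.invKey?]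
    · rw [restrictTid_append, restrictTid_singleton_of_ne (by simpa [Action.tid] using Ne.symm hq)]
      simp [H.ids, hq]
  · by_cases hq : q = p
    · subst hq
      rw [restrictTid_append, restrictTid_singleton_inv, List.getLast?_concat]
      exact Or.inr ⟨fun hm => hkey (mem_invKeys.2 ⟨_, hWh _ hm, trivial, rfl⟩), by simp, by simp⟩
    · rw [restrictTid_append, restrictTid_singleton_of_ne (by simpa [Action.tid] using Ne.symm hq),
        List.append_nil]
      exact (H.thread q).congr (fun _ _ => rfl) rfl (by simp [hq]) rfl (by simp [hq])
  · intro a ha haw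
    rcases List.mem_append.1 ha with ha | ha
    · rcases H.done a ha haw with h1 | h1
      · exact Or.inl h1
      · by_cases hq : a.tid = p
        · rw [hq] at h1
          exact absurd (hlast a h1) (not_isRes_of_isInv haw.isInv)
        · rw [restrictTid_append,
            restrictTid_singleton_of_ne (by simpa [Action.tid] using Ne.symm hq), List.append_nil]
          exact Or.inr h1
    · rw [List.mem_singleton] at ha
      subst ha
      rw [restrictTid_append, restrictTid_singleton_self, List.getLast?_concat]
      exact Or.inr rfl

/-- The history part of a response by thread `p`, after which `p` is back in its main location. -/
theorem Sim.res {h W : RegHistory Tid Id} {m : ℕ} {μ : Tid → ℕ} {s s' : State Tid Id}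
    (H : Sim h W m μ s) {b : RegAction Tid Id} (hb : b.IsRes) {a : RegAction Tid Id}
    (ha : (restrictTid h b.tid).getLast? = some a) (haW : IsWriteInv a → a ∈ W.take m)
    (hval : s'.val = s.val) (hids : s'.ids = s.ids) (hpc : s'.pc b.tid = .main)
    (hother : ∀ q, q ≠ b.tid → s'.pc q = s.pc q ∧ s'.vs q = s.vs q ∧ s'.arg q = s.arg q) :
    Sim (h ++ [b]) W m μ s' := by
  refine ⟨H.le, hval.trans H.val, fun q => ?_, fun q => ?_, ?_⟩
  · have : (restrictTid [b] q).filterMap Action.invKey? = [] := by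
      by_cases hq : b.tid = q
      · rw [restrictTid_singleton_of_eq hq, List.filterMap_cons_none (invKey?_of_isRes hb)]; rfl
      · rw [restrictTid_singleton_of_ne hq]; rfl
    rw [hids, H.ids, restrictTid_append, List.filterMap_append, this, List.append_nil]
  · by_cases hq : q = b.tid
    · subst hq
      rw [restrictTid_append, restrictTid_singleton_self, List.getLast?_concat]
      match b with
      | .res _ _ _ _ => exact hpc
      | .inv _ _ _ _ => exact hb.elim
    · rw [restrictTid_append, restrictTid_singleton_of_ne (Ne.symm hq), List.append_nil]
      obtain ⟨h₁, h₂, h₃⟩ := hother q hq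
      exact (H.thread q).congr (fun _ _ => rfl) rfl h₁ h₂ h₃
  · intro c hc hcw
    rcases List.mem_append.1 hc with hc | hc
    · rcases H.done c hc hcw with h1 | h1
      · exact Or.inl h1
      · by_cases hq : c.tid = b.tid
        · rw [hq, ha] at h1
          obtain rfl := Option.some.inj h1
          exact Or.inl (haW hcw)
        · rw [restrictTid_append, restrictTid_singleton_of_ne (Ne.symm hq), List.append_nil]
          exact Or.inr h1
    · rw [List.mem_singleton] at hc
      subst hc
      exact absurd hb (not_isRes_of_isInv hcw.isInv)

theorem exists_pending {h : RegHistory Tid Id} {b : RegAction Tid Id} (hb : b.IsRes)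
    (hw : WellFormed (h ++ [b])) : ∃ a, (restrictTid h b.tid).getLast? = some a ∧ a.IsInv ∧
      a.method = b.method ∧ a.key = b.key ∧ a ∈ h := by
  have h1 := (hw b.tid).1
  rw [restrictTid_append, restrictTid_singleton_self] at h1
  obtain ⟨l, a, hl, ha, hm, hk⟩ := h1.exists_inv rfl hb
  have hlast : (restrictTid h b.tid).getLast? = some a := by rw [hl, List.getLast?_concat]
  exact ⟨a, hlast, ha, hm, hk, (mem_restrictTid.1 (List.mem_of_getLast? hlast)).1⟩

end WSR

/-! ### Simulating a write strongly-linearizable implementation -/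

open History

namespace WSR

section Simulation

variable {Tid : Type t} {Id : Type k} {Q : Type u} {ι : Type v}
  {I : LTS Q (RegAction Tid Id ⊕ ι)} {L : I.Exec → RegHistory Tid Id}

/-- In the linearizations of all extensions of `e`, at least `m` writes precede `o`. -/
def Bound (L : I.Exec → RegHistory Tid Id) (e : I.Exec) (o : Tid × Id) (m : ℕ) : Prop :=
  ∀ e', e.IsPrefix e' → ∀ A i B, L e' = A ++ i :: B → i.IsInv → i.key = o →
    m ≤ (writeInvs A).length

/-- In the linearizations of all extensions of `e`, at least `m` writes precede each of the
operations that are invoked after `e`. -/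
def Safe (L : I.Exec → RegHistory Tid Id) (e : I.Exec) (m : ℕ) : Prop :=
  ∀ o, o ∉ e.hist.filterMap Action.invKey? → Bound L e o m

theorem Bound.mono {e e' : I.Exec} {o : Tid × Id} {m : ℕ} (h : Bound L e o m)
    (he : e.IsPrefix e') : Bound L e' o m :=
  fun e'' he' => h e'' (List.IsPrefix.trans he he')

theorem hist_append (e e' : I.Exec) (ts : List I.Transition) (he : e'.1 = e.1 ++ ts) :
    e'.hist = e.hist ++ external (ts.map LTS.Transition.label) := by
  rw [LTS.Exec.hist, LTS.Exec.trace, he, List.map_append, external_append]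
  rfl

theorem exists_hist_eq_append {e e' : I.Exec} (h : e.IsPrefix e') :
    ∃ h₂, e'.hist = e.hist ++ h₂ := by
  obtain ⟨ts, hts⟩ := h
  exact ⟨_, hist_append e e' ts hts.symm⟩

theorem Safe.mono {e e' : I.Exec} {m : ℕ} (h : Safe L e m) (he : e.IsPrefix e') :
    Safe L e' m := by
  intro o ho
  refine (h o fun hm => ho ?_).mono he
  obtain ⟨h₂, hh⟩ := exists_hist_eq_append he
  rw [hh, List.filterMap_append]
  exact List.mem_append_left _ hm

theorem writeInvs_prefix (hS : IsWriteStrong I L) {e e' : I.Exec} (he : e.IsPrefix e') :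
    writeInvs (L e) <+: writeInvs (L e') := by
  have := (hS e e' he).filter (fun a => @decide (IsWriteInv a) (Classical.propDecidable _))
  rw [← writeInvs_restrictMethod, ← writeInvs_restrictMethod (L e')]
  exact this

/-- Real-time order puts the completed write before every later operation, and write strength
together with distinctness of the writes keeps its index `j` in all extensions. With it, `j + 1`
writes come first. -/
theorem safe_of_write_completed (hI : IsRegisterImplementation I) (hL : IsLinearizationMapping I L)
    (hS : IsWriteStrong I L) {e : I.Exec} {a b : RegAction Tid Id} (ha : a ∈ e.hist)
    (hb : b ∈ e.hist) (haw : IsWriteInv a) (hbr : b.IsRes) (hk : a.key = b.key) {j : ℕ}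
    (hj : j < (writeInvs (L e)).length) (hja : (writeInvs (L e))[j] = a) : Safe L e (j + 1) := by
  intro o ho e' he A i B hA hi hio
  obtain ⟨h₂, hh⟩ := exists_hist_eq_append he
  obtain ⟨A₁, r, A₂, rfl⟩ := (hL e').2.precedes (hI e').1 hh ha hb haw.isInv hbr hk hA hi
    (by rw [hio]; exact ho)
  have hn : (writeInvs (L e')).Nodup := nodup_writeInvs (hL e').1.1.2
  have hpre := writeInvs_prefix hS he
  have hA' : writeInvs (A₁ ++ a :: r :: A₂) <+: writeInvs (L e') := by
    rw [hA, writeInvs_append _ (i :: B)]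
    exact List.prefix_append _ _
  have hmem : a ∈ writeInvs (A₁ ++ a :: r :: A₂) := mem_writeInvs.2 ⟨by simp, haw⟩
  obtain ⟨j', hj', hja'⟩ := List.getElem_of_mem hmem
  have h1 : (writeInvs (L e'))[j]'(hj.trans_le hpre.length_le) = a :=
    (hpre.getElem hj).symm.trans hja
  have h2 : (writeInvs (L e'))[j']'(hj'.trans_le hA'.length_le) = a :=
    (hA'.getElem hj').symm.trans hja'
  have := (hn.getElem_inj_iff).1 (h1.trans h2.symm)
  omega

theorem exists_read_split (hI : IsRegisterImplementation I) (hL : IsLinearizationMapping I L)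
    {e : I.Exec} {a b : RegAction Tid Id} (ha : a ∈ e.hist)
    (hb : b ∈ e.hist) (hai : a.IsInv) (har : a.method = .read) (hbr : b.IsRes)
    (hk : a.key = b.key) :
    ∃ A B, L e = A ++ a :: b :: B ∧
      ∃ p k, b = .res .read (some (valueAfter 0 (writeInvs A))) p k := by
  obtain ⟨A, B, hAB⟩ := (hL e).2.eq_append (hI e).1 ha hb hai hbr hk
  exact ⟨A, B, hAB, RegLegal.read (hAB ▸ (hL e).1.2) hai har⟩

/-- An extension may move the read among the writes, but it must return `n` and keep `m₀` writes
before it. A place with fewer than `j` writes before it would have as its writes a prefix of those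
of `L e`, and by `hmin` the value there is not `n`. Later operations follow the read, so at least
`j` writes precede them as well. -/
theorem safe_of_read_completed (hI : IsRegisterImplementation I) (hL : IsLinearizationMapping I L)
    (hS : IsWriteStrong I L) {e : I.Exec} {a b : RegAction Tid Id} (ha : a ∈ e.hist)
    (hb : b ∈ e.hist) (hai : a.IsInv) (har : a.method = .read) (hbr : b.IsRes)
    (hk : a.key = b.key) {m₀ n j : ℕ} {p : Tid} {k : Id} (hbn : b = .res .read (some n) p k)
    (hB : Bound L e a.key m₀) (hj : j ≤ (writeInvs (L e)).length)
    (hmin : ∀ i, m₀ ≤ i → i < j → valueAfter 0 ((writeInvs (L e)).take i) ≠ n) : Safe L e j := by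
  intro o ho e' he A i B hA hi hio
  obtain ⟨h₂, hh⟩ := exists_hist_eq_append he
  obtain ⟨A₁, r, A₂, rfl⟩ := (hL e').2.precedes (hI e').1 hh ha hb hai hbr hk hA hi
    (by rw [hio]; exact ho)
  have ha' : a ∈ e'.hist := by rw [hh]; exact List.mem_append_left _ ha
  have hb' : b ∈ e'.hist := by rw [hh]; exact List.mem_append_left _ hb
  obtain ⟨A₀, B₀, hAB, p', k', hb₀⟩ := exists_read_split hI hL ha' hb' hai har hbr hk
  have hA₁ : A₁ = A₀ := by
    have h1 : A₁ ++ a :: (r :: A₂ ++ i :: B) = A₀ ++ a :: (b :: B₀) := by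
      rw [← hAB, hA]; simp
    refine (inv_split_unique ?_ h1 hai hai rfl).1
    rw [h1, ← hAB]
    exact (hL e').1.1.2
  subst hA₁
  have hn : n = valueAfter 0 (writeInvs A₁) := by
    rw [hbn] at hb₀
    simpa using (Action.res.inj hb₀).2.1
  have hm₀ := hB e' he A₁ a _ hAB hai rfl
  have hle : (writeInvs A₁).length ≤ (writeInvs (A₁ ++ a :: r :: A₂)).length := by
    rw [writeInvs_append]; simp
  refine le_trans ?_ hle
  by_contra! hlt
  refine hmin _ hm₀ hlt ?_
  have h1 : writeInvs A₁ <+: writeInvs (L e') := by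
    rw [hAB, writeInvs_append]; exact List.prefix_append _ _
  have h2 : writeInvs A₁ <+: writeInvs (L e) :=
    List.prefix_of_prefix_length_le h1 (writeInvs_prefix hS he) (by omega)
  rw [← List.prefix_iff_eq_take.1 h2, hn]

/-- The states of `I` and `WSR` are related by an execution of `I`. -/
structure Related (L : I.Exec → RegHistory Tid Id) (e : I.Exec) (s : State Tid Id) (m : ℕ)
    (μ : Tid → ℕ) : Prop where
  safe : Safe L e m
  bound : ∀ p v k, (restrictTid e.hist p).getLast? = some (.inv .read v p k) →
    Bound L e (p, k) (μ p)
  sim : Sim e.hist (writeInvs (L e)) m μ s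

/-- `WSR` need not move: the new linearization may rearrange reads and append writes, but the `m`
executed writes stay the same. -/
theorem Related.internal (hS : IsWriteStrong I L) {e e' : I.Exec} {s : State Tid Id} {m : ℕ}
    {μ : Tid → ℕ} (H : Related L e s m μ) (he : e.IsPrefix e') (hh : e'.hist = e.hist) :
    Related L e' s m μ where
  safe := H.safe.mono he
  bound p v k hp := (H.bound p v k (hh ▸ hp)).mono he
  sim := hh ▸ H.sim.mono (writeInvs_prefix hS he)

theorem mem_hist_of_mem_writeInvs (hL : IsLinearizationMapping I L) {e : I.Exec}
    {a : RegAction Tid Id} (ha : a ∈ writeInvs (L e)) : a ∈ e.hist ∧ IsWriteInv a := by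
  obtain ⟨h1, h2⟩ := mem_writeInvs.1 ha
  exact ⟨(hL e).2.mem_of_isInv h1 h2.isInv, h2⟩

/-- No write is executed here. For a new read, `Safe` at its fresh identifiers is precisely the
`Bound` required with `μ p = m`. -/
theorem Related.inv (hI : IsRegisterImplementation I) (hL : IsLinearizationMapping I L)
    (hS : IsWriteStrong I L) {e e' : I.Exec} {s : State Tid Id} {m : ℕ}
    {μ : Tid → ℕ} (H : Related L e s m μ) (he : e.IsPrefix e') {b : RegAction Tid Id}
    (hh : e'.hist = e.hist ++ [b]) (hb : b.IsInv) :
    ∃ s' ρ m' μ', (WSR Tid Id).Steps s ρ s' ∧ external ρ = [b] ∧ Related L e' s' m' μ' := by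
  classical
  have hw := (hI e').1
  rw [hh] at hw
  have hsim := H.sim.mono (writeInvs_prefix hS he)
  have hvalid := (hI e').2 b (by rw [hh]; simp)
  obtain ⟨-, -, hkey, -⟩ := H.sim.main_of_inv hb hw
  rcases b with ⟨_ | _, v, p, k⟩ | _
  · obtain rfl : v = none := hvalid
    obtain ⟨s', ρ, hs, hρ, hsim'⟩ := hsim.readInv hw
    refine ⟨s', ρ, m, _, hs, hρ, H.safe.mono he, fun q v' k' hq => ?_, hh ▸ hsim'⟩
    by_cases hqp : q = p
    · subst hqp
      rw [hh, restrictTid_append, restrictTid_singleton_inv, List.getLast?_concat] at hq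
      obtain rfl : k = k' := by
        simp only [Option.some.injEq, Action.inv.injEq] at hq
        exact hq.2.2.2
      rw [Function.update_self]
      exact (H.safe _ hkey).mono he
    · rw [hh, restrictTid_append,
        restrictTid_singleton_of_ne (by simpa [Action.tid] using Ne.symm hqp),
        List.append_nil] at hq
      rw [Function.update_of_ne hqp]
      exact (H.bound q v' k' hq).mono he
  · obtain ⟨n, rfl⟩ : ∃ n, v = some n := hvalid
    obtain ⟨s', ρ, hs, hρ, hsim'⟩ := hsim.writeInv hw (by
      intro a ha
      have h1 : (writeInvs (L e')).take m = (writeInvs (L e)).take m := by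
        obtain ⟨W₂, hW₂⟩ := writeInvs_prefix hS he
        rw [← hW₂]
        exact List.take_append_of_le_length H.sim.le
      rw [h1] at ha
      exact (mem_hist_of_mem_writeInvs hL (List.mem_of_mem_take ha)).1)
    refine ⟨s', ρ, m, μ, hs, hρ, H.safe.mono he, fun q v' k' hq => ?_, hh ▸ hsim'⟩
    by_cases hqp : q = p
    · subst hqp
      rw [hh, restrictTid_append, restrictTid_singleton_inv, List.getLast?_concat] at hq
      simp at hq
    · rw [hh, restrictTid_append,
        restrictTid_singleton_of_ne (by simpa [Action.tid] using Ne.symm hqp),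
        List.append_nil] at hq
      exact (H.bound q v' k' hq).mono he
  · exact hb.elim

/-- `WSR` first executes as many writes of the new linearization as the response requires and then
answers. These writes are already invoked in `e`, since the last action is a response. -/
theorem Related.res (hI : IsRegisterImplementation I) (hL : IsLinearizationMapping I L)
    (hS : IsWriteStrong I L) {e e' : I.Exec} {s : State Tid Id} {m : ℕ}
    {μ : Tid → ℕ} (H : Related L e s m μ) (he : e.IsPrefix e') {b : RegAction Tid Id}
    (hh : e'.hist = e.hist ++ [b]) (hb : b.IsRes) :
    ∃ s' ρ m' μ', (WSR Tid Id).Steps s ρ s' ∧ external ρ = [b] ∧ Related L e' s' m' μ' := by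
  classical
  have hw := (hI e').1
  rw [hh] at hw
  have hsim := H.sim.mono (writeInvs_prefix hS he)
  obtain ⟨a, hlast, hai, ham, hak, hah⟩ := exists_pending hb hw
  have hah' : a ∈ e'.hist := by rw [hh]; exact List.mem_append_left _ hah
  have hbh' : b ∈ e'.hist := by rw [hh]; simp
  have hn : (writeInvs (L e')).Nodup := nodup_writeInvs (hL e').1.1.2
  have hWh : ∀ c ∈ writeInvs (L e'), c ∈ e.hist ∧ IsWriteInv c := by
    intro c hc
    obtain ⟨h1, h2⟩ := mem_hist_of_mem_writeInvs hL hc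
    rw [hh] at h1
    rcases List.mem_append.1 h1 with h1 | h1
    · exact ⟨h1, h2⟩
    · rw [List.mem_singleton] at h1
      subst h1
      exact absurd hb (not_isRes_of_isInv h2.isInv)
  have hbound : ∀ p v k, (restrictTid e'.hist p).getLast? = some (.inv .read v p k) →
      Bound L e' (p, k) (μ p) := by
    intro p v k hp
    by_cases hbp : b.tid = p
    · rw [hh, restrictTid_append, restrictTid_singleton_of_eq hbp, List.getLast?_concat,
        Option.some.injEq] at hp
      subst hp
      exact hb.elim
    · rw [hh, restrictTid_append, restrictTid_singleton_of_ne hbp, List.append_nil] at hp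
      exact (H.bound p v k hp).mono he
  have safe_max : ∀ j, Safe L e' j → Safe L e' (max m j) := by
    intro j hj
    rcases max_choice m j with h | h <;> rw [h]
    · exact H.safe.mono he
    · exact hj
  rcases b with _ | ⟨_ | _, v, p, k⟩
  · exact hb.elim
  · obtain ⟨_ | _, va, pa, ka⟩ | _ := a
    · obtain rfl : pa = p := congrArg Prod.fst hak
      obtain rfl : ka = k := congrArg Prod.snd hak
      simp only [Action.tid] at hlast
      have hBd := (H.bound _ _ _ hlast).mono he
      obtain ⟨A, B, hAB, p', k', hbv⟩ := exists_read_split hI hL hah' hbh' hai rfl hb hak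
      obtain ⟨-, rfl, -, -⟩ := Action.res.inj hbv
      have hApre : writeInvs A <+: writeInvs (L e') := by
        rw [hAB, writeInvs_append]; exact List.prefix_append _ _
      -- The place of the read in `L e'` is one such `j`. The least one is used instead, because
      -- other extensions may put the read earlier.
      have hex : ∃ j, μ pa ≤ j ∧
          valueAfter 0 ((writeInvs (L e')).take j) = valueAfter 0 (writeInvs A) :=
        ⟨(writeInvs A).length, hBd e' List.prefix_rfl A _ _ hAB hai rfl,
          by rw [← List.prefix_iff_eq_take.1 hApre]⟩
      obtain ⟨hj₁, hj₂⟩ := Nat.find_spec hex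
      have hjmin : ∀ i, μ pa ≤ i → i < Nat.find hex →
          valueAfter 0 ((writeInvs (L e')).take i) ≠ valueAfter 0 (writeInvs A) :=
        fun i hi hlt heq => Nat.find_min hex hlt ⟨hi, heq⟩
      have hjle : Nat.find hex ≤ (writeInvs (L e')).length :=
        (Nat.find_min' hex ⟨hBd e' List.prefix_rfl A _ _ hAB hai rfl,
          by rw [← List.prefix_iff_eq_take.1 hApre]⟩).trans hApre.length_le
      have hsafe := safe_max _ (safe_of_read_completed hI hL hS hah' hbh' hai rfl hb hak rfl hBd
        hjle hjmin)
      generalize Nat.find hex = j at hj₁ hj₂ hjle hsafe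
      -- The maximum is needed because `j` may lie below `m`; the value after `j` writes was then
      -- loaded earlier.
      obtain ⟨s₁, ⟨ρ, hρ, hρ'⟩, hs₁⟩ :=
        hsim.advance (le_max_left m j) (max_le hsim.le hjle) hn hWh
      have hth := hs₁.thread pa
      rw [hlast] at hth
      obtain ⟨hpc, -, hvs⟩ := hth
      have hv := hvs j hj₁ (le_max_right m j)
      rw [hj₂] at hv
      have hid := hs₁.getLast?_ids hai hlast
      simp only [Action.id] at hid
      -- The state after the pick is spelled out so that the value in the response label reduces to
      -- the picked one.
      have hstep := Step.readRes { s₁ with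
        pc := Function.update s₁.pc pa .rEnd
        arg := Function.update s₁.arg pa (valueAfter 0 (writeInvs A)) } pa ka (by simp) hid
      simp only [Function.update_self] at hstep
      refine ⟨_, _, max m j, μ, hρ.trans (.cons (.readPick s₁ pa _ hpc hv)
        (.cons hstep (.nil _))), by simp [hρ'], hsafe, hbound, ?_⟩
      rw [hh]
      exact hs₁.res hb hlast (fun hc => hc.elim) rfl rfl (by simp [Action.tid])
        (fun q hq => by simp only [Action.tid] at hq; simp [hq])
    · simp [Action.method] at ham
    · exact hai.elim
  · obtain ⟨_ | _, va, pa, ka⟩ | _ := a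
    · simp [Action.method] at ham
    · obtain rfl : pa = p := congrArg Prod.fst hak
      obtain rfl : ka = k := congrArg Prod.snd hak
      simp only [Action.tid] at hlast
      have hbL := (hL e').2.mem hah' hbh' hai hb hak hbh' rfl
      obtain rfl := (hL e').1.2.write hbL
      have haL : Action.inv RegMethod.write va pa ka ∈ writeInvs (L e') :=
        mem_writeInvs.2 ⟨(hL e').2.mem hah' hbh' hai hb hak hah' hak, trivial⟩
      obtain ⟨j, hj, hja⟩ := List.getElem_of_mem haL
      have hsafe := safe_max _ (safe_of_write_completed hI hL hS hah' hbh' trivial hb hak hj hja)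
      obtain ⟨s₁, ⟨ρ, hρ, hρ'⟩, hs₁⟩ :=
        hsim.advance (le_max_left m (j + 1)) (max_le hsim.le hj) hn hWh
      have hmem : Action.inv RegMethod.write va pa ka ∈
          (writeInvs (L e')).take (max m (j + 1)) := by
        rw [List.mem_take_iff_getElem]
        exact ⟨j, by have := le_max_right m (j + 1); omega, hja⟩
      have hth := hs₁.thread pa
      rw [hlast] at hth
      obtain ⟨-, hpc⟩ := hth.resolve_right fun h1 => h1.1 hmem
      have hid := hs₁.getLast?_ids hai hlast
      simp only [Action.id] at hid
      refine ⟨_, _, max m (j + 1), μ, hρ.trans (.cons (.writeRes s₁ pa ka hpc hid) (.nil _)),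
        by simp [hρ'], hsafe, hbound, ?_⟩
      rw [hh]
      exact hs₁.res hb hlast (fun _ => hmem) rfl rfl (by simp [Action.tid])
        (fun q hq => by simp only [Action.tid] at hq; simp [hq])
    · exact hai.elim

/-- `L` depends on executions and not on states, so the relation asks for some execution that leads
to `q`. -/
theorem forwardSimulated (h : WriteStronglyLinearizable I) : ForwardSimulated I (WSR Tid Id) := by
  obtain ⟨hI, L, hL, hS⟩ := h
  refine ⟨fun q s => ∃ (e : I.Exec) (m : ℕ) (μ : Tid → ℕ),
    LTS.target I.init e.1 = q ∧ Related L e s m μ, ?_, ?_⟩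
  · refine ⟨⟨[], trivial⟩, 0, fun _ => 0, rfl, fun o _ e' _ A i B _ _ _ => Nat.zero_le _,
      fun p v k hp => by simp [LTS.Exec.hist, LTS.Exec.trace] at hp, Nat.zero_le _, rfl,
      fun p => rfl, fun p => rfl, fun a ha => ?_⟩
    simp [LTS.Exec.hist, LTS.Exec.trace] at ha
  · rintro q q₁ l s hl ⟨e, m, μ, rfl, H⟩
    let e' : I.Exec := ⟨e.1 ++ [⟨_, l, q₁, hl⟩], (LTS.isPath_concat _ _ _).2 ⟨e.2, rfl⟩⟩
    have he : e.IsPrefix e' := List.prefix_append _ _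
    have hh : e'.hist = e.hist ++ external [l] := hist_append e e' _ rfl
    have htar : LTS.target I.init e'.1 = q₁ := LTS.target_concat _ _ _
    cases l with
    | inr i =>
      exact ⟨s, [], .nil s, rfl, e', m, μ, htar, H.internal hS he (by rw [hh]; simp)⟩
    | inl b =>
      rw [external_cons_inl, external_nil] at hh ⊢
      obtain ⟨s', ρ, m', μ', hs, hρ, H'⟩ :=
        (isInv_or_isRes b).elim (H.inv hI hL hS he hh) (H.res hI hL hS he hh)
      exact ⟨s', ρ, hs, hρ, e', m', μ', htar, H'⟩

end Simulation

end WSR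

end HyperReg

theorem mainTheorem2 (Tid : Type t) (Id : Type k) :
    HyperReg.WriteStronglyLinearizable (HyperReg.WSR Tid Id) ∧
    ∀ (Q : Type u) (ι : Type v) (I : HyperReg.LTS Q (HyperReg.RegAction Tid Id ⊕ ι)),
      HyperReg.WriteStronglyLinearizable I →
        HyperReg.ForwardSimulated I (HyperReg.WSR Tid Id) ∧
        HyperReg.StronglyRefines.{u, v, max k t, max k t, t, x, y} I (HyperReg.WSR Tid Id) := by
  refine ⟨HyperReg.WSR.writeStronglyLinearizable, fun Q ι I hI => ?_⟩
  have h := HyperReg.WSR.forwardSimulated hI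
  exact ⟨h, h.stronglyRefines⟩
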